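/- Let $q$ be an odd prime power with $q\equiv 3\pmod{10}$ and put $n=\frac{q^2+1}{10}$, $r=q+1$, $s=\frac{q^2+1}{2}$. Let $\lambda$ be an integer with $1\le\lambda\le\frac{q-3}{10}$. Let $\alpha\in\mathbb F_{q^2}^{*}$ be a primitive $r$-th root of unity and let $\delta$, in an extension field of $\mathbb F_{q^2}$, be a primitive $rn$-th root of unity with $\delta^n=\alpha$. An $\alpha$-constacyclic code $\mathcal C\subseteq\mathbb F_{q^2}^n$ is a linear code closed under $(c_0,\dots,c_{n-1})\mapsto(\alpha c_{n-1},c_0,\dots,c_{n-2})$; it corresponds to an ideal $\langle g\rangle$ of $\mathbb F_{q^2}[x]/\langle x^n-\alpha\rangle$ with $g$ monic, $g\mid x^n-\alpha$, and its defining set is $\{i\in\{1+rj: 0\le j\le n-1\} : g(\delta^i)=0\}$, read modulo $rn$. Let $C_i=\{iq^{2j}\bmod rn : j\ge 0\}$ be the $q^2$-cyclotomic coset of $i$ modulo $rn$, and let $$T=\bigcup_{j=0}^{\frac{4(q-3)}{10}+\lambda} C_{s-rj}.$$ Then there is an $\alpha$-constacyclic code of length $n$ over $\mathbb F_{q^2}$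 with defining set $T$, and if $\mathcal C$ is such a code, then there exists an entanglement-assisted quantum code with parameters $$[[\,n,\;k,\;d;\;9\,]]_q,\qquad k=n-\tfrac85(q-3)-4\lambda+7,\qquad d=\tfrac45(q-3)+2\lambda+2,$$ and these parameters satisfy $n+9-k=2(d-1)$, i.e. equality in the entanglement-assisted Singleton bound $n+c-k\ge 2(d-1)$, as well as, if $q\ne 13$, the inequality $d\le\frac{n+2}{2}$ (so that the code is an EAQMDS code). Here an entanglement-assisted code $[[n,k,d;c]]_q$, $k\ge1$, is given by an isometry $V:(\mathbb C^q)^{\otimes k}\otimes(\mathbb C^q)^{\otimes c}\to(\mathbb C^q)^{\otimes n}$. A state $\varphi$ of $k$ logical $q$-level systems is encoded as $(V\otimes I)(\varphi\otimes\Phi)$, where $\Phi=q^{-c/2}\sum_a|a\rangle|a\rangle$ is the state of $c$ maximally entangled pairs, whose second halves stay with the receiver and are free of errors. An error $E$ on the $n$ transmitted systems is detected if $P(E\otimes I)P=\mu P$ for some scalar $\mu$, where $P$ is the projection onto the space of encoded states. The code has minimum distance $d$ if every error acting on fewer than $d$ of the $n$ systems is detected and some error acting on $d$ of them is not. -/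

import Mathlib

open Polynomial

/-! ### Constacyclic codes -/

/-- The `α`-constacyclic shift `(c₀, …, c_{n-1}) ↦ (α c_{n-1}, c₀, …, c_{n-2})`. -/
def constacyclicShift {F : Type*} [Field F] {n : ℕ} (α : F) (c : Fin n → F) : Fin n → F :=
  fun i => if (i : ℕ) = 0 then α * c ⟨n - 1, by have := i.isLt; omega⟩
    else c ⟨(i : ℕ) - 1, by have := i.isLt; omega⟩

/-- A linear code of length `n` over `F` that is closed under the `α`-constacyclic shift. -/
def IsConstacyclic {F : Type*} [Field F] {n : ℕ} (α : F) (𝒞 : Submodule F (Fin n → F)) : Prop :=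
  ∀ c ∈ 𝒞, constacyclicShift α c ∈ 𝒞

/-- The polynomial `c₀ + c₁ x + ⋯ + c_{n-1} x^{n-1}` of a word. -/
noncomputable def wordPoly {F : Type*} [Field F] {n : ℕ} (c : Fin n → F) : F[X] :=
  ∑ i : Fin n, C (c i) * X ^ (i : ℕ)

/-- `g` is the generator polynomial of `𝒞`: a monic divisor of `x ^ n - α` such that `𝒞`
corresponds to the ideal `⟨g⟩` of `F[x] / ⟨x ^ n - α⟩`. (As `g ∣ x ^ n - α`, the class of a
polynomial lies in that ideal exactly when `g` divides the polynomial.) -/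
def IsGeneratorPoly {F : Type*} [Field F] {n : ℕ} (α : F) (𝒞 : Submodule F (Fin n → F))
    (g : F[X]) : Prop :=
  g.Monic ∧ g ∣ X ^ n - C α ∧ ∀ c : Fin n → F, c ∈ 𝒞 ↔ g ∣ wordPoly c

/-- The set `𝒪_{rn} = {1 + r j | 0 ≤ j ≤ n - 1}` of residues modulo `r n`. -/
def rootExponents (r n : ℕ) : Set (ZMod (r * n)) :=
  {i | ∃ j : ℕ, j < n ∧ i = 1 + (r : ZMod (r * n)) * (j : ZMod (r * n))}

/-- The defining set `{i ∈ 𝒪_{rn} | δ ^ i is a root of g}`, where `δ` is a primitive `rn`-th root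
of unity in an extension field `K` of `F`. -/
def definingSet {F K : Type*} [Field F] [Field K] [Algebra F K] (r n : ℕ) (δ : K) (g : F[X]) :
    Set (ZMod (r * n)) :=
  {i | i ∈ rootExponents r n ∧ aeval (δ ^ i.val) g = 0}

/-- `𝒞` is an `α`-constacyclic code of length `n` whose defining set (with respect to `δ`)
is `T`. -/
def IsConstacyclicWithDefiningSet {F K : Type*} [Field F] [Field K] [Algebra F K] (r n : ℕ)
    (α : F) (δ : K) (𝒞 : Submodule F (Fin n → F)) (T : Set (ZMod (r * n))) : Prop :=
  IsConstacyclic α 𝒞 ∧ ∃ g : F[X], IsGeneratorPoly α 𝒞 g ∧ definingSet r n δ g = T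

/-- The `Q`-cyclotomic coset of `i` modulo `N` (here `Q` is prime to `N`, so that nonnegative
exponents suffice). -/
def cyclotomicCoset (Q N : ℕ) (i : ZMod N) : Set (ZMod N) :=
  {x | ∃ j : ℕ, x = i * (Q : ZMod N) ^ j}

/-! ### Entanglement-assisted quantum codes

The state space of `m` qudits with level set `A` is the space of functions `(Fin m → A) → ℂ`,
the standard basis being indexed by the words `Fin m → A`. -/

/-- The state of `c` maximally entangled pairs of qudits, the sender's halves listed first:
`|A|^{-c/2} ∑ₐ |a⟩|a⟩`. -/
noncomputable def maxEntangled (A : Type*) [Fintype A] [DecidableEq A] (c : ℕ)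
    (a b : Fin c → A) : ℂ :=
  if a = b then ((1 / Real.sqrt ((Fintype.card A : ℝ) ^ c) : ℝ) : ℂ) else 0

/-- The encoded state of `φ`, a state of `k` logical qudits. The sender applies `V` to the logical
qudits and to her halves of `c` maximally entangled pairs; the result consists of the `n` qudits
sent through the channel and the `c` qudits that the receiver holds. -/
noncomputable def eaEncode {A : Type*} [Fintype A] [DecidableEq A] {n k c : ℕ}
    (V : Matrix (Fin n → A) ((Fin k → A) × (Fin c → A)) ℂ) (φ : (Fin k → A) → ℂ) :
    (Fin n → A) × (Fin c → A) → ℂ :=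
  fun p => ∑ l : Fin k → A, ∑ a : Fin c → A, V p.1 (l, a) * (φ l * maxEntangled A c a p.2)

/-- The operator `E` on `n` qudits acts as the identity on all qudits outside `S`,
that is, `E = M ⊗ 1` for an operator `M` on the qudits in `S`. -/
def ActsOn {A : Type*} {n : ℕ} (S : Finset (Fin n))
    (E : Matrix (Fin n → A) (Fin n → A) ℂ) : Prop :=
  ∃ M : Matrix (S → A) (S → A) ℂ,
    (∀ x y : Fin n → A, (∀ i, i ∉ S → x i = y i) →
      E x y = M (fun i => x i) (fun i => y i)) ∧
    (∀ x y : Fin n → A, ¬ (∀ i, i ∉ S → x i = y i) → E x y = 0)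

/-- The error `E ⊗ 1` on the joint system, `E` acting on the `n` transmitted qudits and the
receiver's `c` qudits being free of errors. -/
noncomputable def applyError {A : Type*} [Fintype A] {n c : ℕ}
    (E : Matrix (Fin n → A) (Fin n → A) ℂ) (ψ : (Fin n → A) × (Fin c → A) → ℂ) :
    (Fin n → A) × (Fin c → A) → ℂ :=
  fun p => ∑ y : Fin n → A, E p.1 y * ψ (y, p.2)

/-- The Knill–Laflamme condition for the detection of `E`: `P (E ⊗ 1) P = μ P` for some scalar `μ`,
where `P` is the projection onto the space of encoded states. -/
def Detects {A : Type*} [Fintype A] [DecidableEq A] {n k c : ℕ}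
    (V : Matrix (Fin n → A) ((Fin k → A) × (Fin c → A)) ℂ)
    (E : Matrix (Fin n → A) (Fin n → A) ℂ) : Prop :=
  ∃ μ : ℂ, ∀ φ ψ : (Fin k → A) → ℂ,
    star (eaEncode V φ) ⬝ᵥ applyError E (eaEncode V ψ) =
      μ * (star (eaEncode V φ) ⬝ᵥ eaEncode V ψ)

/-- `V` is the encoder of an entanglement-assisted quantum code `[[n, k, d; c]]` (`k ≥ 1`) on qudits
with level set `A`: it is an isometry (a unitary operator on `n` qudits, `n - k - c` of which are
ancillas in a fixed state), every error on fewer than `d` of the transmitted qudits is detected,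
and some error on `d` of them is not. -/
def IsEAQECC {A : Type*} [Fintype A] [DecidableEq A] (n k d c : ℕ)
    (V : Matrix (Fin n → A) ((Fin k → A) × (Fin c → A)) ℂ) : Prop :=
  V.conjTranspose * V = 1 ∧
  (∀ (S : Finset (Fin n)) (E : Matrix (Fin n → A) (Fin n → A) ℂ),
    S.card < d → ActsOn S E → Detects V E) ∧
  (∃ (S : Finset (Fin n)) (E : Matrix (Fin n → A) (Fin n → A) ℂ),
    S.card = d ∧ ActsOn S E ∧ ¬ Detects V E)

/-- There is an entanglement-assisted quantum code `[[n, k, d; c]]_q`: it encodes `k ≥ 1` logical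
`q`-level systems into `n` with the help of `c` maximally entangled pairs, and its minimum distance
is `d`. -/
def ExistsEAQECC (q n k d c : ℕ) : Prop :=
  1 ≤ k ∧ ∃ V : Matrix (Fin n → Fin q) ((Fin k → Fin q) × (Fin c → Fin q)) ℂ,
    IsEAQECC n k d c V

/-!
The zeros of `𝒞` are `δ ^ (s + r j) = ω β ^ j` with `|j| ≤ m = 4 (q - 3) / 10 + λ`, where
`ω = δ ^ s` and `β = δ ^ r` is a primitive `n`-th root of unity: `2 m + 1` consecutive zeros, so the
BCH bound shows that `𝒞` is an MDS code of minimum distance `2 m + 2`. The Hermitian dual of the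
code with zeros `Z` is the code whose zeros are all the roots of `x ^ n - α` outside the image of
`Z` under `z ↦ z ^ (-q)`; hence the Hermitian hull of `𝒞` has codimension `|Z ∩ Z ^ (-q)|` in the
dual, and this number is the number of ebits. As `ω ^ (-q) = ω`, it counts the pairs `(l, j)` in
`[-m, m] ^ 2` with `n ∣ q l + j`. For `q = 10 t + 3` this divisibility defines the lattice spanned
by `(t, 3 t + 1)` and `(3 t + 1, -t)`, and exactly its nine points with coefficients in
`{-1, 0, 1}` lie in the square.

The quantum code comes from the Weyl operators of the trace-symplectic space `𝒞`: the radical of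
`𝒞ᗮ` is simultaneously diagonalised, and hyperbolic pairs of `𝒞` and of `𝒞ᗮ` modulo the
radical act as the logical operators on the logical qudits and on the ebits. Averaging an error
over the operators of `𝒞ᗮ` shows that it is detected unless its support carries a nonzero
word of `𝒞`. The minimum distance is attained because an MDS code is spanned by its words of
minimum weight, so not all of them lie in the hull.
-/

open scoped Matrix

/-- A hyperbolic family for `ω`: two families spanning isotropic subspaces and dual to each other,
that is, the symplectic basis of a (possibly empty) sum of hyperbolic planes. -/
structure IsHyperbolicFamily {A V κ : Type*} [CommRing A] [AddCommGroup V] [Module A V]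
    [DecidableEq κ] (ω : LinearMap.BilinForm A V) (x y : κ → V) : Prop where
  left_left : ∀ i j, ω (x i) (x j) = 0
  right_right : ∀ i j, ω (y i) (y j) = 0
  left_right : ∀ i j, ω (x i) (y j) = if i = j then 1 else 0

section Hyperbolic

variable {A V : Type*} [Field A] [AddCommGroup V] [Module A V] {ω : LinearMap.BilinForm A V}

/-- The vectors of `N` orthogonal to the pair `e`, `f`. -/
def pairComplement (ω : LinearMap.BilinForm A V) (N : Submodule A V) (e f : V) : Submodule A V :=
  N ⊓ LinearMap.ker ((ω e).prod (ω f))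

lemma mem_pairComplement {N : Submodule A V} {e f z : V} :
    z ∈ pairComplement ω N e f ↔ z ∈ N ∧ ω e z = 0 ∧ ω f z = 0 := by
  simp [pairComplement]

lemma exists_sub_mem_pairComplement (hω : ω.IsAlt) {N : Submodule A V} {e f : V} (he : e ∈ N)
    (hf : f ∈ N) (hef : ω e f = 1) {z : V} (hz : z ∈ N) :
    ∃ a b : A, ∃ z' ∈ pairComplement ω N e f, z = z' + (a • e + b • f) := by
  have hfe : ω f e = -1 := by rw [← hω.neg_eq e f, hef]
  refine ⟨-ω f z, ω e z, z - (-ω f z • e + ω e z • f), mem_pairComplement.2 ⟨?_, ?_, ?_⟩, by abel⟩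
  · exact N.sub_mem hz (N.add_mem (N.smul_mem _ he) (N.smul_mem _ hf))
  · simp [hω.self_eq_zero, hef]
  · simp [hω.self_eq_zero, hfe]

lemma finrank_pairComplement_add_two [FiniteDimensional A V] (hω : ω.IsAlt) {N : Submodule A V}
    {e f : V} (he : e ∈ N) (hf : f ∈ N) (hef : ω e f = 1) :
    Module.finrank A (pairComplement ω N e f) + 2 = Module.finrank A N := by
  have hfe : ω f e = -1 := by rw [← hω.neg_eq e f, hef]
  set L := ((ω e).prod (ω f)).domRestrict N
  have hsurj : LinearMap.range L = ⊤ := by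
    refine LinearMap.range_eq_top.2 fun p =>
      ⟨⟨-p.2 • e + p.1 • f, N.add_mem (N.smul_mem _ he) (N.smul_mem _ hf)⟩, ?_⟩
    ext <;> simp [L, hω.self_eq_zero, hef, hfe]
  have hker : (LinearMap.ker L).map N.subtype = pairComplement ω N e f := by
    ext z; simp [L, mem_pairComplement]; tauto
  have hdim := L.finrank_range_add_finrank_ker
  rw [hsurj, finrank_top, Module.finrank_prod, Module.finrank_self] at hdim
  rw [← hker, Submodule.finrank_map_subtype_eq]
  omega

lemma pairComplement_inf_orthogonal (hω : ω.IsAlt) {N : Submodule A V} {e f : V} (he : e ∈ N)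
    (hf : f ∈ N) (hef : ω e f = 1) :
    pairComplement ω N e f ⊓ ω.orthogonal (pairComplement ω N e f) = N ⊓ ω.orthogonal N := by
  ext z
  simp only [Submodule.mem_inf, LinearMap.BilinForm.mem_orthogonal_iff]
  constructor
  · rintro ⟨hz, hort⟩
    obtain ⟨hzN, hez, hfz⟩ := mem_pairComplement.1 hz
    refine ⟨hzN, fun w hw => ?_⟩
    obtain ⟨a, b, w', hw', rfl⟩ := exists_sub_mem_pairComplement hω he hf hef hw
    simp [hort w' hw', hez, hfz]
  · rintro ⟨hz, hort⟩
    exact ⟨mem_pairComplement.2 ⟨hz, hort e he, hort f hf⟩,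
      fun w hw => hort w (mem_pairComplement.1 hw).1⟩

lemma IsHyperbolicFamily.cons (hω : ω.IsAlt) {N : Submodule A V} {e f : V} {k : ℕ} {x y : Fin k → V}
    (hef : ω e f = 1) (hxy : IsHyperbolicFamily ω x y)
    (hx : ∀ i, x i ∈ pairComplement ω N e f) (hy : ∀ i, y i ∈ pairComplement ω N e f) :
    IsHyperbolicFamily ω (Fin.cons e x : Fin (k + 1) → V) (Fin.cons f y : Fin (k + 1) → V) := by
  have hex i : ω e (x i) = 0 := (mem_pairComplement.1 (hx i)).2.1
  have hfy i : ω f (y i) = 0 := (mem_pairComplement.1 (hy i)).2.2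
  have hey i : ω e (y i) = 0 := (mem_pairComplement.1 (hy i)).2.1
  have hxe i : ω (x i) e = 0 := hω.isRefl _ _ (hex i)
  have hyf i : ω (y i) f = 0 := hω.isRefl _ _ (hfy i)
  have hxf i : ω (x i) f = 0 := hω.isRefl _ _ (mem_pairComplement.1 (hx i)).2.2
  refine ⟨fun i j => ?_, fun i j => ?_, fun i j => ?_⟩
  · cases i using Fin.cases <;> cases j using Fin.cases <;>
      simp [hω.self_eq_zero, hex, hxe, hxy.left_left]
  · cases i using Fin.cases <;> cases j using Fin.cases <;>
      simp [hω.self_eq_zero, hfy, hyf, hxy.right_right]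
  · cases i using Fin.cases <;> cases j using Fin.cases <;>
      simp [hef, hey, hxf, hxy.left_right, Fin.succ_ne_zero, (Fin.succ_ne_zero _).symm]

/-- The subspace of `N` spanned by its radical `N ⊓ N^⊥` and the family `y`. -/
def radicalSupSpan {κ : Type*} (ω : LinearMap.BilinForm A V) (N : Submodule A V) (y : κ → V) :
    Submodule A V :=
  N ⊓ ω.orthogonal N ⊔ Submodule.span A (Set.range y)

/-- A symplectic basis of `N` modulo its radical: a hyperbolic family in `N` that spans `N`
together with the radical `N ⊓ N^⊥`. -/
structure IsSymplecticBasis {κ : Type*} [DecidableEq κ] (ω : LinearMap.BilinForm A V)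
    (N : Submodule A V) (x y : κ → V) : Prop extends IsHyperbolicFamily ω x y where
  left_mem : ∀ i, x i ∈ N
  right_mem : ∀ i, y i ∈ N
  le_sup : N ≤ radicalSupSpan ω N y ⊔ Submodule.span A (Set.range x)

lemma IsSymplecticBasis.cons (hω : ω.IsAlt) {N : Submodule A V} {e f : V} {k : ℕ} {x y : Fin k → V}
    (he : e ∈ N) (hf : f ∈ N) (hef : ω e f = 1)
    (hxy : IsSymplecticBasis ω (pairComplement ω N e f) x y) :
    IsSymplecticBasis ω N (Fin.cons e x : Fin (k + 1) → V) (Fin.cons f y : Fin (k + 1) → V) where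
  toIsHyperbolicFamily :=
    IsHyperbolicFamily.cons hω hef hxy.toIsHyperbolicFamily hxy.left_mem hxy.right_mem
  left_mem := Fin.cases he fun i => (mem_pairComplement.1 (hxy.left_mem i)).1
  right_mem := Fin.cases hf fun i => (mem_pairComplement.1 (hxy.right_mem i)).1
  le_sup z hz := by
    obtain ⟨a, b, z', hz', rfl⟩ := exists_sub_mem_pairComplement hω he hf hef hz
    have hcover := hxy.le_sup hz'
    rw [radicalSupSpan, pairComplement_inf_orthogonal hω he hf hef] at hcover
    rw [radicalSupSpan, Fin.range_cons, Fin.range_cons]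
    have hmono (s : Set V) (v : V) : Submodule.span A s ≤ Submodule.span A (insert v s) :=
      Submodule.span_mono (Set.subset_insert v s)
    refine add_mem (sup_le_sup (sup_le_sup_left (hmono _ f) _) (hmono _ e) hcover) (add_mem ?_ ?_)
    · exact Submodule.mem_sup_right
        (Submodule.smul_mem _ _ (Submodule.subset_span (Set.mem_insert _ _)))
    · exact Submodule.mem_sup_left (Submodule.mem_sup_right
        (Submodule.smul_mem _ _ (Submodule.subset_span (Set.mem_insert _ _))))

namespace IsSymplecticBasis

variable {κ : Type*} [DecidableEq κ] {N : Submodule A V} {x y : κ → V}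

lemma radicalSupSpan_le (hxy : IsSymplecticBasis ω N x y) : radicalSupSpan ω N y ≤ N :=
  sup_le inf_le_left (Submodule.span_le.2 (Set.range_subset_iff.2 hxy.right_mem))

lemma radicalSupSpan_le_orthogonal (hω : ω.IsAlt) (hxy : IsSymplecticBasis ω N x y) :
    radicalSupSpan ω N y ≤ ω.orthogonal (radicalSupSpan ω N y) := by
  have hyy j : radicalSupSpan ω N y ≤ LinearMap.ker (ω.flip (y j)) :=
    sup_le (fun z hz => hω.isRefl _ _ (hz.2 _ (hxy.right_mem j)))
      (Submodule.span_le.2 (Set.range_subset_iff.2 fun i => hxy.right_right i j))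
  exact sup_le (inf_le_right.trans (LinearMap.BilinForm.orthogonal_le hxy.radicalSupSpan_le))
    (Submodule.span_le.2 (Set.range_subset_iff.2 fun j z hz => hyy j hz))

lemma exists_eq_add_linearCombination [Fintype κ] (hxy : IsSymplecticBasis ω N x y) {z : V}
    (hz : z ∈ N) : ∃ ρ ∈ radicalSupSpan ω N y, ∃ a : κ → A,
      z = ρ + Fintype.linearCombination A x a := by
  obtain ⟨ρ, hρ, w, hw, rfl⟩ := Submodule.mem_sup.1 (hxy.le_sup hz)
  rw [← Fintype.range_linearCombination] at hw
  obtain ⟨a, rfl⟩ := hw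
  exact ⟨ρ, hρ, a, rfl⟩

end IsSymplecticBasis

lemma IsHyperbolicFamily.apply_linearCombination_left {κ : Type*} [DecidableEq κ] [Fintype κ]
    {x y : κ → V} (hxy : IsHyperbolicFamily ω x y) (a : κ → A) (j : κ) :
    ω (Fintype.linearCombination A x a) (y j) = a j := by
  simp [Fintype.linearCombination_apply, hxy.left_right]

lemma IsHyperbolicFamily.apply_linearCombination_linearCombination {κ : Type*} [DecidableEq κ]
    [Fintype κ] {x y : κ → V} (hxy : IsHyperbolicFamily ω x y) (a b : κ → A) :
    ω (Fintype.linearCombination A x a) (Fintype.linearCombination A x b) = 0 := by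
  simp [Fintype.linearCombination_apply, hxy.left_left]

lemma sup_le_orthogonal_sup (hω : ω.IsRefl) {M N : Submodule A V} (hM : M ≤ ω.orthogonal M)
    (hN : N ≤ ω.orthogonal N) (hMN : M ≤ ω.orthogonal N) : M ⊔ N ≤ ω.orthogonal (M ⊔ N) := by
  intro z hz w hw
  obtain ⟨m, hm, n, hn, rfl⟩ := Submodule.mem_sup.1 hz
  obtain ⟨m', hm', n', hn', rfl⟩ := Submodule.mem_sup.1 hw
  simp [hM hm m' hm', hMN hm n' hn', hω _ _ (hMN hm' n hn), hN hn n' hn']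

lemma exists_mem_apply_eq_one {N : Submodule A V} {e : V} (hω : ω.IsAlt) (he : e ∉ ω.orthogonal N) :
    ∃ f ∈ N, ω e f = 1 := by
  simp only [LinearMap.BilinForm.mem_orthogonal_iff, not_forall] at he
  obtain ⟨f, hf, hfe⟩ := he
  have hef : ω e f ≠ 0 := fun h => hfe (hω.isRefl _ _ h)
  exact ⟨(ω e f)⁻¹ • f, N.smul_mem _ hf, by simp [hef]⟩

theorem exists_isSymplecticBasis [FiniteDimensional A V] (hω : ω.IsAlt) {N : Submodule A V} {k : ℕ}
    (hN : Module.finrank A N = Module.finrank A ↥(N ⊓ ω.orthogonal N) + 2 * k) :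
    ∃ x y : Fin k → V, IsSymplecticBasis ω N x y := by
  induction k generalizing N with
  | zero =>
    have hrad : N ⊓ ω.orthogonal N = N :=
      Submodule.eq_of_le_of_finrank_eq inf_le_left (by omega)
    refine ⟨0, 0, ⟨by simp, by simp, by simp⟩, by simp, by simp, ?_⟩
    rw [radicalSupSpan, hrad]
    exact le_sup_of_le_left le_sup_left
  | succ k ih =>
    obtain ⟨e, he, he'⟩ : ∃ e ∈ N, e ∉ ω.orthogonal N := by
      by_contra! h
      rw [inf_eq_left.2 h] at hN
      omega
    obtain ⟨f, hf, hef⟩ := exists_mem_apply_eq_one hω he'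
    obtain ⟨x, y, hxy⟩ := ih (N := pairComplement ω N e f) (by
      rw [pairComplement_inf_orthogonal hω he hf hef]
      have := finrank_pairComplement_add_two hω he hf hef
      omega)
    exact ⟨_, _, hxy.cons hω he hf hef⟩

theorem exists_isSymplecticBasis_left_zero [FiniteDimensional A V] (hω : ω.IsAlt)
    {N : Submodule A V} {k : ℕ}
    (hN : Module.finrank A N = Module.finrank A ↥(N ⊓ ω.orthogonal N) + 2 * (k + 1))
    {e : V} (he : e ∈ N) (he' : e ∉ ω.orthogonal N) :
    ∃ x y : Fin (k + 1) → V, IsSymplecticBasis ω N x y ∧ x 0 = e := by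
  obtain ⟨f, hf, hef⟩ := exists_mem_apply_eq_one hω he'
  obtain ⟨x, y, hxy⟩ := exists_isSymplecticBasis (k := k) hω (N := pairComplement ω N e f) (by
    rw [pairComplement_inf_orthogonal hω he hf hef]
    have := finrank_pairComplement_add_two hω he hf hef
    omega)
  exact ⟨_, _, hxy.cons hω he hf hef, rfl⟩

end Hyperbolic

lemma star_addChar_mul_self {A : Type*} [AddGroup A] [Finite A] (χ : AddChar A ℂ) (a : A) :
    star (χ a) * χ a = 1 := by
  rw [← starRingEnd_apply, Complex.conj_mul', AddChar.norm_apply]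
  norm_num

lemma exists_addChar_apply_mul_ne_one {A : Type*} [Field A] {χ : AddChar A ℂ}
    (hχ : χ.IsPrimitive) {a : A} (ha : a ≠ 0) : ∃ b, χ (a * b) ≠ 1 := by
  by_contra! h
  exact hχ ha (AddChar.eq_one_iff.2 h)

section Weyl

variable {A ι : Type*} [Field A] [Fintype ι]

/-- The standard symplectic form on `A^ι × A^ι`. -/
def sympForm : LinearMap.BilinForm A ((ι → A) × (ι → A)) :=
  (dotProductBilin A A).compl₁₂ (LinearMap.snd A _ _) (LinearMap.fst A _ _) -
    (dotProductBilin A A).compl₁₂ (LinearMap.fst A _ _) (LinearMap.snd A _ _)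

lemma sympForm_apply (z w : (ι → A) × (ι → A)) : sympForm z w = z.2 ⬝ᵥ w.1 - z.1 ⬝ᵥ w.2 := rfl

lemma isAlt_sympForm : (sympForm : LinearMap.BilinForm A ((ι → A) × (ι → A))).IsAlt := fun z => by
  rw [sympForm_apply, dotProduct_comm, sub_self]

lemma sympForm_single_snd [DecidableEq ι] (i : ι) (a : A) (w : (ι → A) × (ι → A)) :
    sympForm (0, Pi.single i a) w = a * w.1 i := by
  simp [sympForm_apply]

lemma sympForm_single_fst [DecidableEq ι] (i : ι) (a : A) (w : (ι → A) × (ι → A)) :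
    sympForm (Pi.single i a, 0) w = -(a * w.2 i) := by
  simp [sympForm_apply]

lemma sympForm_nondegenerate :
    (sympForm : LinearMap.BilinForm A ((ι → A) × (ι → A))).Nondegenerate := by
  classical
  have hright : LinearMap.SeparatingRight (sympForm : LinearMap.BilinForm A ((ι → A) × (ι → A))) :=
    fun w hw => by
      ext i
      · simpa [sympForm_single_snd] using hw (0, Pi.single i 1)
      · simpa [sympForm_single_fst] using hw (Pi.single i 1, 0)
  refine (LinearMap.IsRefl.nondegenerate_iff_separatingRight fun z w h => ?_).2 hright
  exact isAlt_sympForm.isRefl z w h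

/-- The vectors `z` of `A^ι × A^ι` all of whose coordinates `(z.1 i, z.2 i)` with `i ∈ T` vanish. -/
def vanishingOn {ι : Type*} (A : Type*) [Field A] (T : Finset ι) :
    Submodule A ((ι → A) × (ι → A)) :=
  ⨅ i ∈ T, LinearMap.ker ((LinearMap.proj i).prodMap (LinearMap.proj i))

lemma mem_vanishingOn {A ι : Type*} [Field A] {T : Finset ι} {z : (ι → A) × (ι → A)} :
    z ∈ vanishingOn A T ↔ ∀ i ∈ T, z.1 i = 0 ∧ z.2 i = 0 := by
  simp [vanishingOn]

/-- The symplectic weight: the number of coordinates `i` at which `(z.1 i, z.2 i) ≠ 0`. -/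
def sympWeight {A ι : Type*} [Field A] [DecidableEq A] [Fintype ι] (z : (ι → A) × (ι → A)) : ℕ :=
  hammingNorm fun i => (z.1 i, z.2 i)

lemma sup_vanishingOn_eq_top [DecidableEq A]
    {S : Submodule A ((ι → A) × (ι → A))} {T : Finset ι}
    (hS : ∀ z ∈ sympForm.orthogonal S, z ≠ 0 → T.card < sympWeight z) :
    S ⊔ vanishingOn A T = ⊤ := by
  classical
  suffices h : sympForm.orthogonal (S ⊔ vanishingOn A T) = ⊥ by
    rw [← LinearMap.BilinForm.orthogonal_orthogonal sympForm_nondegenerate isAlt_sympForm.isRefl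
      (S ⊔ vanishingOn A T), h, LinearMap.BilinForm.orthogonal_bot]
  refine eq_bot_iff.2 fun z hz => ?_
  have horth {w} (hw : w ∈ S ⊔ vanishingOn A T) : sympForm w z = 0 :=
    LinearMap.BilinForm.mem_orthogonal_iff.1 hz w hw
  have hsupp : sympWeight z ≤ T.card := by
    refine Finset.card_le_card fun i hi => ?_
    by_contra hiT
    refine (Finset.mem_filter.1 hi).2 (Prod.ext ?_ ?_)
    · simpa [sympForm_single_snd] using horth (w := (0, Pi.single i 1))
        (Submodule.mem_sup_right (mem_vanishingOn.2 fun j hj => by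
          simp [ne_of_mem_of_not_mem hj hiT]))
    · simpa [sympForm_single_fst] using horth (w := (Pi.single i 1, 0))
        (Submodule.mem_sup_right (mem_vanishingOn.2 fun j hj => by
          simp [ne_of_mem_of_not_mem hj hiT]))
  by_contra hz0
  exact (hS z (LinearMap.BilinForm.mem_orthogonal_iff.2 fun w hw =>
    horth (Submodule.mem_sup_left hw)) hz0).not_ge hsupp

/-- The Weyl operator of `(a, b) ∈ A^ι × A^ι`: it maps the basis vector `|v⟩` to
`χ (b ⬝ (v + a / 2)) |v + a⟩`. The shift by `a / 2` makes `weyl χ z` and `weyl χ (-z)` adjoint. -/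
noncomputable def weyl [DecidableEq A] (χ : AddChar A ℂ) (z : (ι → A) × (ι → A)) :
    Matrix (ι → A) (ι → A) ℂ :=
  Matrix.of fun u v => if u = v + z.1 then χ (z.2 ⬝ᵥ (v + (2 : A)⁻¹ • z.1)) else 0

variable [DecidableEq A] (χ : AddChar A ℂ)

lemma weyl_zero : weyl χ (0 : (ι → A) × (ι → A)) = 1 := by
  ext u v
  simp [weyl, Matrix.one_apply]

lemma weyl_conjTranspose [Finite A] (h2 : (2 : A) ≠ 0) (z : (ι → A) × (ι → A)) :
    (weyl χ z)ᴴ = weyl χ (-z) := by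
  ext u v
  simp only [weyl, Matrix.conjTranspose_apply, Matrix.of_apply, Prod.fst_neg, Prod.snd_neg,
    ← sub_eq_add_neg, eq_sub_iff_add_eq, eq_comm (a := v)]
  split_ifs with h
  · rw [← starRingEnd_apply, ← AddChar.map_neg_eq_conj, ← h]
    congr 1
    simp only [dotProduct_add, neg_dotProduct, smul_neg, dotProduct_neg, dotProduct_smul,
      smul_eq_mul]
    field_simp
    ring
  · exact star_zero ℂ

variable [Fintype A] [DecidableEq ι]

lemma weyl_mul (h2 : (2 : A) ≠ 0) (z w : (ι → A) × (ι → A)) :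
    weyl χ z * weyl χ w = χ (sympForm z w / 2) • weyl χ (z + w) := by
  ext u v
  rw [Matrix.mul_apply, Finset.sum_eq_single (v + w.1) (by simp +contextual [weyl]) (by simp)]
  simp only [weyl, Matrix.of_apply, Matrix.smul_apply, smul_eq_mul, if_true, Prod.fst_add]
  rw [show v + w.1 + z.1 = v + (z.1 + w.1) by abel]
  split_ifs with h
  · rw [← AddChar.map_add_eq_mul, ← AddChar.map_add_eq_mul, sympForm_apply]
    congr 1
    simp only [Prod.snd_add, dotProduct_add, add_dotProduct, dotProduct_smul, smul_eq_mul,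
      dotProduct_comm z.1 w.2]
    field_simp
    ring
  · simp

lemma weyl_comm (h2 : (2 : A) ≠ 0) (z w : (ι → A) × (ι → A)) :
    weyl χ z * weyl χ w = χ (sympForm z w) • (weyl χ w * weyl χ z) := by
  rw [weyl_mul χ h2, weyl_mul χ h2, smul_smul, ← AddChar.map_add_eq_mul, add_comm w z,
    ← isAlt_sympForm.neg_eq z w]
  congr 2
  field_simp
  ring

lemma weyl_conjTranspose_mul_self (h2 : (2 : A) ≠ 0) (z : (ι → A) × (ι → A)) :
    (weyl χ z)ᴴ * weyl χ z = 1 := by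
  rw [weyl_conjTranspose χ h2, weyl_mul χ h2, map_neg, LinearMap.neg_apply,
    isAlt_sympForm.self_eq_zero]
  simp [weyl_zero]

/-- Conjugation of an operator by the Weyl operator of `z`. -/
noncomputable def weylConj (z : (ι → A) × (ι → A)) (E : Matrix (ι → A) (ι → A) ℂ) :
    Matrix (ι → A) (ι → A) ℂ :=
  (weyl χ z)ᴴ * E * weyl χ z

lemma weylConj_apply (z : (ι → A) × (ι → A)) (E : Matrix (ι → A) (ι → A) ℂ) (u v : ι → A) :
    weylConj χ z E u v = χ (z.2 ⬝ᵥ (v - u)) * E (u + z.1) (v + z.1) := by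
  rw [weylConj, Matrix.mul_apply,
    Finset.sum_eq_single (v + z.1) (by simp +contextual [weyl]) (by simp), Matrix.mul_apply,
    Finset.sum_eq_single (u + z.1) (by simp +contextual [weyl]) (by simp)]
  simp only [weyl, Matrix.conjTranspose_apply, Matrix.of_apply, if_true]
  rw [← starRingEnd_apply, ← AddChar.map_neg_eq_conj, mul_right_comm, ← AddChar.map_add_eq_mul,
    ← dotProduct_neg, ← dotProduct_add]
  congr 3
  abel

lemma weylConj_add (z w : (ι → A) × (ι → A)) (E : Matrix (ι → A) (ι → A) ℂ) :
    weylConj χ (z + w) E = weylConj χ w (weylConj χ z E) := by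
  ext u v
  simp only [weylConj_apply, Prod.fst_add, Prod.snd_add]
  rw [← mul_assoc, ← AddChar.map_add_eq_mul, add_sub_add_right_eq_sub, ← add_dotProduct]
  rw [add_comm z.2, add_right_comm, add_right_comm v, add_assoc, add_assoc]

lemma eq_smul_one_of_weylConj_eq (hχ : χ.IsPrimitive) {E : Matrix (ι → A) (ι → A) ℂ}
    (hE : ∀ z, weylConj χ z E = E) : E = E 0 0 • (1 : Matrix (ι → A) (ι → A) ℂ) := by
  ext u v
  rcases eq_or_ne u v with rfl | huv
  · simpa [weylConj_apply] using congrFun₂ (hE (u, 0)) 0 0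
  · obtain ⟨i, hi⟩ := Function.ne_iff.1 huv
    obtain ⟨b, hb⟩ := exists_addChar_apply_mul_ne_one hχ (sub_ne_zero.2 hi.symm)
    have hEuv := congrFun₂ (hE (0, Pi.single i b)) u v
    simp only [weylConj_apply, single_dotProduct, Pi.sub_apply, add_zero, mul_comm b] at hEuv
    have hzero : E u v = 0 := by_contra fun hne => hb ((mul_eq_right₀ hne).1 hEuv)
    simpa [huv] using hzero

lemma weylConj_sum {S : Type*} (s : Finset S) (z : (ι → A) × (ι → A))
    (E : S → Matrix (ι → A) (ι → A) ℂ) :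
    weylConj χ z (∑ i ∈ s, E i) = ∑ i ∈ s, weylConj χ z (E i) := by
  simp only [weylConj, Finset.mul_sum, Finset.sum_mul]

lemma sum_weylConj_eq_smul_one (hχ : χ.IsPrimitive) {S N : Submodule A ((ι → A) × (ι → A))}
    [Fintype S] (hSN : S ⊔ N = ⊤) {E : Matrix (ι → A) (ι → A) ℂ}
    (hE : ∀ z ∈ N, weylConj χ z E = E) :
    ∃ μ : ℂ, ∑ s : S, weylConj χ (s : (ι → A) × (ι → A)) E =
      μ • (1 : Matrix (ι → A) (ι → A) ℂ) := by
  refine ⟨_, eq_smul_one_of_weylConj_eq χ hχ fun z => ?_⟩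
  obtain ⟨t, ht, w, hw, rfl⟩ := Submodule.mem_sup.1 (hSN ▸ Submodule.mem_top : z ∈ S ⊔ N)
  rw [add_comm, weylConj_add, weylConj_sum, weylConj_sum]
  refine Fintype.sum_equiv (Equiv.addRight (⟨t, ht⟩ : S)) _ _ fun s => ?_
  rw [← weylConj_add, ← weylConj_add, Equiv.coe_addRight, Submodule.coe_add,
    add_left_comm, weylConj_add, hE w hw]

lemma weylConj_eq_of_actsOn {n : ℕ} {T : Finset (Fin n)}
    {E : Matrix (Fin n → A) (Fin n → A) ℂ} (hE : ActsOn T E) {z : (Fin n → A) × (Fin n → A)}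
    (hz : z ∈ vanishingOn A T) : weylConj χ z E = E := by
  obtain ⟨M, hM, hM0⟩ := hE
  rw [mem_vanishingOn] at hz
  ext u v
  rw [weylConj_apply]
  by_cases huv : ∀ i, i ∉ T → u i = v i
  · have hphase : z.2 ⬝ᵥ (v - u) = 0 := Finset.sum_eq_zero fun i _ => by
      by_cases hi : i ∈ T
      · simp [(hz i hi).2]
      · simp [huv i hi]
    have hrestrict (w : Fin n → A) : (fun i : T => (w + z.1) i) = fun i : T => w i :=
      funext fun i => by simp [(hz i i.2).1]
    rw [hphase, AddChar.map_zero_eq_one, one_mul, hM u v huv,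
      hM (u + z.1) (v + z.1) fun i hi => by simp [huv i hi], hrestrict, hrestrict]
  · rw [hM0 u v huv, hM0 _ _ (by simpa using huv), mul_zero]

end Weyl

section FixedVector

lemma exists_star_dotProduct_self_smul_eq_one {ι : Type*} [Fintype ι] {w : ι → ℂ} (hw : w ≠ 0) :
    ∃ c : ℂ, star (c • w) ⬝ᵥ (c • w) = 1 := by
  set u := WithLp.toLp 2 w
  have hu : ‖u‖ ≠ 0 := norm_ne_zero_iff.2 fun h => hw (congrArg WithLp.ofLp h)
  refine ⟨(‖u‖⁻¹ : ℝ), ?_⟩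
  have hunit : ‖((‖u‖⁻¹ : ℝ) : ℂ) • u‖ = 1 := by
    rw [norm_smul, Complex.norm_real, norm_inv, norm_norm, inv_mul_cancel₀ hu]
  have hinner := inner_self_eq_norm_sq_to_K (𝕜 := ℂ) (((‖u‖⁻¹ : ℝ) : ℂ) • u)
  rw [hunit, EuclideanSpace.inner_eq_star_dotProduct, dotProduct_comm] at hinner
  simpa [u] using hinner

variable {A ι : Type*} [Field A] [Fintype A] [DecidableEq A] [Fintype ι] [DecidableEq ι]
  (χ : AddChar A ℂ)

/-- The vectors fixed by the Weyl operators of `M`: the stabilizer code of `M`. -/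
def IsStabilized (M : Submodule A ((ι → A) × (ι → A))) (v : (ι → A) → ℂ) : Prop :=
  ∀ z ∈ M, weyl χ z *ᵥ v = v

lemma isStabilized_sum_weyl_mulVec (h2 : (2 : A) ≠ 0) {M : Submodule A ((ι → A) × (ι → A))}
    [Fintype M] (hM : M ≤ sympForm.orthogonal M) (v : (ι → A) → ℂ) :
    IsStabilized χ M (∑ m : M, weyl χ (m : (ι → A) × (ι → A)) *ᵥ v) := by
  intro z hz
  rw [Matrix.mulVec_sum]
  refine Fintype.sum_equiv (Equiv.addLeft (⟨z, hz⟩ : M)) _ _ fun m => ?_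
  rw [Matrix.mulVec_mulVec, weyl_mul χ h2, hM m.2 z hz]
  simp

/-- Symmetrizing `|0⟩` over `M` gives a nonzero vector, since each `(0, b) ∈ M` fixes `|0⟩`. -/
lemma exists_isStabilized (h2 : (2 : A) ≠ 0) {M : Submodule A ((ι → A) × (ι → A))}
    (hM : M ≤ sympForm.orthogonal M) :
    ∃ v : (ι → A) → ℂ, star v ⬝ᵥ v = 1 ∧ IsStabilized χ M v := by
  classical
  set w : (ι → A) → ℂ := ∑ m : M, weyl χ (m : (ι → A) × (ι → A)) *ᵥ Pi.single 0 1 with hw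
  have hw0 : w 0 = (Finset.univ.filter fun m : M => (m : (ι → A) × (ι → A)).1 = 0).card := by
    rw [hw, Finset.sum_apply, Finset.card_filter, Nat.cast_sum]
    refine Finset.sum_congr rfl fun m _ => ?_
    by_cases h : (m : (ι → A) × (ι → A)).1 = 0 <;>
      simp [weyl, h, eq_comm (a := (0 : ι → A))]
  have hne : w ≠ 0 := fun h => by
    rw [h, Pi.zero_apply, eq_comm, Nat.cast_eq_zero, Finset.card_eq_zero] at hw0
    exact Finset.notMem_empty (0 : M) (hw0 ▸ by simp)
  obtain ⟨c, hc⟩ := exists_star_dotProduct_self_smul_eq_one hne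
  exact ⟨c • w, hc, fun z hz => by
    rw [Matrix.mulVec_smul, isStabilized_sum_weyl_mulVec χ h2 hM _ z hz]⟩

lemma star_dotProduct_weyl_mulVec_eq_zero (hχ : χ.IsPrimitive) (h2 : (2 : A) ≠ 0)
    {M : Submodule A ((ι → A) × (ι → A))} {v : (ι → A) → ℂ} (hv : IsStabilized χ M v)
    {m z : (ι → A) × (ι → A)} (hm : m ∈ M) (hmz : sympForm m z ≠ 0) :
    star v ⬝ᵥ (weyl χ z *ᵥ v) = 0 := by
  obtain ⟨b, hb⟩ := exists_addChar_apply_mul_ne_one hχ hmz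
  have hbm := hv (b • m) (M.smul_mem b hm)
  have h : star v ⬝ᵥ (weyl χ z *ᵥ v) = χ (sympForm m z * b) * (star v ⬝ᵥ (weyl χ z *ᵥ v)) := by
    calc star v ⬝ᵥ (weyl χ z *ᵥ v)
        = star v ⬝ᵥ (((weyl χ (b • m))ᴴ * weyl χ (b • m)) *ᵥ (weyl χ z *ᵥ v)) := by
          rw [weyl_conjTranspose_mul_self χ h2, Matrix.one_mulVec]
      _ = star (weyl χ (b • m) *ᵥ v) ⬝ᵥ ((weyl χ (b • m) * weyl χ z) *ᵥ v) := by
          rw [Matrix.star_mulVec, ← Matrix.dotProduct_mulVec, Matrix.mulVec_mulVec,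
            Matrix.mulVec_mulVec, Matrix.mul_assoc]
      _ = χ (sympForm m z * b) * (star v ⬝ᵥ (weyl χ z *ᵥ v)) := by
          rw [hbm, weyl_comm χ h2, Matrix.smul_mulVec, dotProduct_smul, smul_eq_mul,
            ← Matrix.mulVec_mulVec, hbm, map_smul, LinearMap.smul_apply, smul_eq_mul, mul_comm b]
  by_contra hne
  exact hb ((mul_eq_right₀ hne).1 h.symm)

lemma star_weyl_mulVec_dotProduct_weyl_mulVec (h2 : (2 : A) ≠ 0) (v : (ι → A) → ℂ)
    (y z : (ι → A) × (ι → A)) :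
    star (weyl χ y *ᵥ v) ⬝ᵥ (weyl χ z *ᵥ v) =
      χ (sympForm (-y) z / 2) * (star v ⬝ᵥ (weyl χ (-y + z) *ᵥ v)) := by
  rw [Matrix.star_mulVec, ← Matrix.dotProduct_mulVec, Matrix.mulVec_mulVec,
    weyl_conjTranspose χ h2, weyl_mul χ h2, Matrix.smul_mulVec, dotProduct_smul, smul_eq_mul]

end FixedVector

lemma actsOn_weyl {A : Type*} [Field A] [DecidableEq A] (χ : AddChar A ℂ) {n : ℕ}
    {T : Finset (Fin n)} {z : (Fin n → A) × (Fin n → A)}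
    (hz : ∀ i ∉ T, z.1 i = 0 ∧ z.2 i = 0) : ActsOn T (weyl χ z) := by
  refine ⟨weyl χ (fun i : T => z.1 i, fun i : T => z.2 i), fun u v huv => ?_, fun u v huv => ?_⟩
  · have hshift : u = v + z.1 ↔ (fun i : T => u i) = (fun i : T => v i) + fun i : T => z.1 i := by
      refine ⟨fun h => by rw [h]; rfl, fun h => funext fun i => ?_⟩
      by_cases hi : i ∈ T
      · exact congrFun h ⟨i, hi⟩
      · simp [huv i hi, (hz i hi).1]
    have hphase : z.2 ⬝ᵥ (v + (2 : A)⁻¹ • z.1) =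
        (fun i : T => z.2 i) ⬝ᵥ ((fun i : T => v i) + (2 : A)⁻¹ • fun i : T => z.1 i) := by
      refine (Finset.sum_subset (Finset.subset_univ T) fun i _ hi => ?_).symm.trans
        (Finset.sum_coe_sort T fun i => z.2 i * (v + (2 : A)⁻¹ • z.1) i).symm
      rw [(hz i hi).2, zero_mul]
    simp only [weyl, Matrix.of_apply, hshift, hphase]
  · refine if_neg fun h => huv fun i hi => ?_
    simp [h, (hz i hi).1]

section Detection

variable {A : Type*} {n k c : ℕ} (V : Matrix (Fin n → A) ((Fin k → A) × (Fin c → A)) ℂ)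

/-- The block `V (· ⊗ |b⟩)` of an encoder, obtained by fixing the sender's halves of the entangled
pairs to the basis state `|b⟩`. -/
def encoderBlock (b : Fin c → A) : Matrix (Fin n → A) (Fin k → A) ℂ :=
  V.submatrix id fun l => (l, b)

variable [Fintype A]

/-- The partial trace of `Vᴴ * E * V` over the sender's halves of the entangled pairs. -/
def partialTrace (E : Matrix (Fin n → A) (Fin n → A) ℂ) : Matrix (Fin k → A) (Fin k → A) ℂ :=
  ∑ b, (encoderBlock V b)ᴴ * E * encoderBlock V b

lemma partialTrace_smul (μ : ℂ) (E : Matrix (Fin n → A) (Fin n → A) ℂ) :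
    partialTrace V (μ • E) = μ • partialTrace V E := by
  simp [partialTrace, Finset.smul_sum]

lemma partialTrace_sum {ι : Type*} (s : Finset ι) (E : ι → Matrix (Fin n → A) (Fin n → A) ℂ) :
    partialTrace V (∑ i ∈ s, E i) = ∑ i ∈ s, partialTrace V (E i) := by
  simp only [partialTrace, Matrix.mul_sum, Matrix.sum_mul]
  exact Finset.sum_comm

variable [DecidableEq A]

lemma eaEncode_apply (φ : (Fin k → A) → ℂ) (p : Fin n → A) (b : Fin c → A) :
    eaEncode V φ (p, b) =
      ((1 / √((Fintype.card A : ℝ) ^ c) : ℝ) : ℂ) * (encoderBlock V b *ᵥ φ) p := by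
  simp only [eaEncode, maxEntangled, mul_ite, mul_zero, Finset.sum_ite_eq', Finset.mem_univ,
    if_true, Matrix.mulVec, dotProduct, encoderBlock, Matrix.submatrix_apply, id_eq,
    Finset.mul_sum]
  exact Finset.sum_congr rfl fun l _ => by ring

lemma star_eaEncode_dotProduct_applyError (E : Matrix (Fin n → A) (Fin n → A) ℂ)
    (φ ψ : (Fin k → A) → ℂ) :
    star (eaEncode V φ) ⬝ᵥ applyError E (eaEncode V ψ) =
      ((Fintype.card A : ℂ) ^ c)⁻¹ * (star φ ⬝ᵥ (partialTrace V E *ᵥ ψ)) := by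
  set r : ℂ := ((1 / √((Fintype.card A : ℝ) ^ c) : ℝ) : ℂ) with hr
  have hrr : star r * r = ((Fintype.card A : ℂ) ^ c)⁻¹ := by
    rw [← starRingEnd_apply, hr, Complex.conj_ofReal, ← Complex.ofReal_mul, div_mul_div_comm,
      Real.mul_self_sqrt (by positivity)]
    simp
  have hblock b : (fun p => eaEncode V φ (p, b)) = r • (encoderBlock V b *ᵥ φ) :=
    funext fun p => eaEncode_apply V φ p b
  have herror b : (fun p => applyError E (eaEncode V ψ) (p, b)) =
      r • (E *ᵥ (encoderBlock V b *ᵥ ψ)) := by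
    rw [← Matrix.mulVec_smul]
    exact congrArg (E *ᵥ ·) (funext fun p => eaEncode_apply V ψ p b)
  calc star (eaEncode V φ) ⬝ᵥ applyError E (eaEncode V ψ)
      = ∑ b, star (fun p => eaEncode V φ (p, b)) ⬝ᵥ
          fun p => applyError E (eaEncode V ψ) (p, b) := by
        simp only [dotProduct, Fintype.sum_prod_type_right, Pi.star_apply]
    _ = ∑ b, star r * r * (star φ ⬝ᵥ
          (((encoderBlock V b)ᴴ * E * encoderBlock V b) *ᵥ ψ)) := by
        refine Finset.sum_congr rfl fun b _ => ?_
        rw [hblock, herror, star_smul, smul_dotProduct, dotProduct_smul, smul_eq_mul, smul_eq_mul,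
          ← mul_assoc, Matrix.star_mulVec, ← Matrix.dotProduct_mulVec, Matrix.mulVec_mulVec,
          Matrix.mulVec_mulVec, Matrix.mul_assoc]
    _ = ((Fintype.card A : ℂ) ^ c)⁻¹ * (star φ ⬝ᵥ (partialTrace V E *ᵥ ψ)) := by
        rw [← Finset.mul_sum, hrr, partialTrace, Matrix.sum_mulVec, dotProduct_sum]

lemma applyError_one (ψ : (Fin n → A) × (Fin c → A) → ℂ) : applyError 1 ψ = ψ := by
  ext p
  simp [applyError, Matrix.one_apply]

lemma detects_iff [Nonempty A] (E : Matrix (Fin n → A) (Fin n → A) ℂ) :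
    Detects V E ↔ ∃ μ : ℂ, partialTrace V E = μ • partialTrace V 1 := by
  have hcard : ((Fintype.card A : ℂ) ^ c)⁻¹ ≠ 0 := by simp
  have hinner (μ : ℂ) (φ ψ : (Fin k → A) → ℂ) :
      star (eaEncode V φ) ⬝ᵥ applyError E (eaEncode V ψ) =
          μ * (star (eaEncode V φ) ⬝ᵥ eaEncode V ψ) ↔
        star φ ⬝ᵥ (partialTrace V E *ᵥ ψ) = star φ ⬝ᵥ ((μ • partialTrace V 1) *ᵥ ψ) := by
    rw [← applyError_one (eaEncode V ψ), star_eaEncode_dotProduct_applyError, applyError_one,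
      star_eaEncode_dotProduct_applyError, mul_left_comm, mul_right_inj' hcard, Matrix.smul_mulVec,
      dotProduct_smul, smul_eq_mul]
  refine exists_congr fun μ => ?_
  simp only [hinner]
  refine ⟨fun h => Matrix.ext fun l l' => ?_, fun h φ ψ => by rw [h]⟩
  simpa [Pi.star_single] using h (Pi.single l 1) (Pi.single l' 1)

variable {V}

lemma conjTranspose_encoderBlock_mul_self (hV : Vᴴ * V = 1) (b : Fin c → A) :
    (encoderBlock V b)ᴴ * encoderBlock V b = 1 := by
  have h : (encoderBlock V b)ᴴ * encoderBlock V b =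
      (Vᴴ * V).submatrix (fun l => (l, b)) fun l => (l, b) := rfl
  rw [h, hV, Matrix.submatrix_one _ fun l l' h => (Prod.ext_iff.1 h).1]

lemma partialTrace_eq_of_mul_encoderBlock (hV : Vᴴ * V = 1)
    {E : Matrix (Fin n → A) (Fin n → A) ℂ} {σ : (Fin k → A) → (Fin k → A)}
    (hE : ∀ b, E * encoderBlock V b = (encoderBlock V b).submatrix id σ) :
    partialTrace V E = (Fintype.card A : ℂ) ^ c • (1 : Matrix (Fin k → A) (Fin k → A) ℂ).submatrix
      id σ := by
  have h b : (encoderBlock V b)ᴴ * E * encoderBlock V b =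
      (1 : Matrix (Fin k → A) (Fin k → A) ℂ).submatrix id σ := by
    rw [Matrix.mul_assoc, hE, ← conjTranspose_encoderBlock_mul_self hV b]
    rfl
  simp only [partialTrace, h, Finset.sum_const, Finset.card_univ, Fintype.card_pi,
    Finset.prod_const, Fintype.card_fin]
  rw [← Nat.cast_smul_eq_nsmul ℂ, Nat.cast_pow]

lemma not_detects_of_mul_encoderBlock [Nonempty A] (hV : Vᴴ * V = 1)
    {E : Matrix (Fin n → A) (Fin n → A) ℂ} {σ : (Fin k → A) → (Fin k → A)}
    (hE : ∀ b, E * encoderBlock V b = (encoderBlock V b).submatrix id σ) {l : Fin k → A}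
    (hl : σ l ≠ l) : ¬ Detects V E := by
  rw [detects_iff]
  rintro ⟨μ, hμ⟩
  rw [partialTrace_eq_of_mul_encoderBlock hV hE,
    partialTrace_eq_of_mul_encoderBlock (σ := id) hV (by simp)] at hμ
  have hentry := congrFun₂ hμ (σ l) l
  simp [Matrix.one_apply, hl] at hentry

end Detection

namespace IsSymplecticBasis

variable {A V κ κ' : Type*} [Field A] [AddCommGroup V] [Module A V] [DecidableEq κ]
  [DecidableEq κ'] [Fintype κ] [Fintype κ'] {ω : LinearMap.BilinForm A V} {D S : Submodule A V}
  {xD yD : κ → V} {xS yS : κ' → V}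

lemma linearCombination_mem (hD : IsSymplecticBasis ω D xD yD) (a : κ → A) :
    Fintype.linearCombination A xD a ∈ D :=
  Submodule.sum_mem _ fun i _ => D.smul_mem _ (hD.left_mem i)

lemma apply_coprod_coprod (hω : ω.IsAlt) (hD : IsSymplecticBasis ω D xD yD)
    (hS : IsSymplecticBasis ω S xS yS) (hDS : D ≤ ω.orthogonal S) (p p' : (κ → A) × (κ' → A)) :
    ω ((Fintype.linearCombination A xD).coprod (Fintype.linearCombination A xS) p)
      ((Fintype.linearCombination A xD).coprod (Fintype.linearCombination A xS) p') = 0 := by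
  have hSD {a b} : ω (Fintype.linearCombination A xS b) (Fintype.linearCombination A xD a) = 0 :=
    hDS (hD.linearCombination_mem a) _ (hS.linearCombination_mem b)
  simp [hSD, hω.isRefl _ _ hSD, hD.apply_linearCombination_linearCombination,
    hS.apply_linearCombination_linearCombination]

lemma exists_apply_coprod_ne_zero (hω : ω.IsAlt) (hD : IsSymplecticBasis ω D xD yD)
    (hS : IsSymplecticBasis ω S xS yS) (hDS : D ≤ ω.orthogonal S) {p : (κ → A) × (κ' → A)}
    (hp : p ≠ 0) :
    ∃ m ∈ radicalSupSpan ω D yD ⊔ radicalSupSpan ω S yS,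
      ω m ((Fintype.linearCombination A xD).coprod (Fintype.linearCombination A xS) p) ≠ 0 := by
  suffices h : ∃ m ∈ radicalSupSpan ω D yD ⊔ radicalSupSpan ω S yS,
      ω ((Fintype.linearCombination A xD).coprod (Fintype.linearCombination A xS) p) m ≠ 0 by
    obtain ⟨m, hm, hne⟩ := h
    exact ⟨m, hm, fun h0 => hne (hω.isRefl _ _ h0)⟩
  have hy (j) : yD j ∈ radicalSupSpan ω D yD :=
    Submodule.mem_sup_right (Submodule.subset_span (Set.mem_range_self j))
  have hy' (j) : yS j ∈ radicalSupSpan ω S yS :=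
    Submodule.mem_sup_right (Submodule.subset_span (Set.mem_range_self j))
  by_cases ha : p.1 = 0
  · obtain ⟨j, hj⟩ := Function.ne_iff.1 fun hb : p.2 = 0 => hp (Prod.ext ha hb)
    refine ⟨yS j, Submodule.mem_sup_right (hy' j), ?_⟩
    simpa [ha, hS.apply_linearCombination_left] using hj
  · obtain ⟨j, hj⟩ := Function.ne_iff.1 ha
    refine ⟨yD j, Submodule.mem_sup_left (hy j), ?_⟩
    have hSD : ω (Fintype.linearCombination A xS p.2) (yD j) = 0 :=
      hDS (hD.right_mem j) _ (hS.linearCombination_mem p.2)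
    simpa [hSD, hD.apply_linearCombination_left] using hj

end IsSymplecticBasis

section SymplecticCode

variable {A : Type*} [Field A] [Fintype A] [DecidableEq A] {χ : AddChar A ℂ} {n k c : ℕ}

lemma partialTrace_weylConj {V : Matrix (Fin n → A) ((Fin k → A) × (Fin c → A)) ℂ}
    {z : (Fin n → A) × (Fin n → A)} {σ : Equiv.Perm (Fin c → A)} {θ : (Fin c → A) → A}
    (hV : ∀ b, weyl χ z * encoderBlock V b = χ (θ b) • encoderBlock V (σ b))
    (E : Matrix (Fin n → A) (Fin n → A) ℂ) :
    partialTrace V (weylConj χ z E) = partialTrace V E := by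
  refine Fintype.sum_equiv σ _ _ fun b => ?_
  calc (encoderBlock V b)ᴴ * weylConj χ z E * encoderBlock V b
      = (weyl χ z * encoderBlock V b)ᴴ * E * (weyl χ z * encoderBlock V b) := by
        simp only [weylConj, Matrix.conjTranspose_mul, Matrix.mul_assoc]
    _ = (star (χ (θ b)) * χ (θ b)) • ((encoderBlock V (σ b))ᴴ * E * encoderBlock V (σ b)) := by
        rw [hV, Matrix.conjTranspose_smul, Matrix.smul_mul, Matrix.smul_mul, Matrix.mul_smul,
          smul_smul]
    _ = (encoderBlock V (σ b))ᴴ * E * encoderBlock V (σ b) := by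
        rw [star_addChar_mul_self, one_smul]

/-- Averaging `E` over the Weyl operators of `S` does not change its partial trace, and the average
is a scalar, as it commutes with all Weyl operators. -/
lemma detects_of_partialTrace_weylConj (hχ : χ.IsPrimitive)
    {V : Matrix (Fin n → A) ((Fin k → A) × (Fin c → A)) ℂ}
    {S N : Submodule A ((Fin n → A) × (Fin n → A))} (hSN : S ⊔ N = ⊤)
    {E : Matrix (Fin n → A) (Fin n → A) ℂ} (hN : ∀ z ∈ N, weylConj χ z E = E)
    (hS : ∀ z ∈ S, partialTrace V (weylConj χ z E) = partialTrace V E) : Detects V E := by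
  classical
  obtain ⟨μ, hμ⟩ := sum_weylConj_eq_smul_one χ hχ hSN hN
  have hcard : (Fintype.card S : ℂ) ≠ 0 := Nat.cast_ne_zero.2 Fintype.card_ne_zero
  have hsum : (Fintype.card S : ℂ) • partialTrace V E = μ • partialTrace V 1 := by
    rw [← partialTrace_smul V μ, ← hμ, partialTrace_sum,
      Finset.sum_congr rfl fun (s : S) _ => hS _ s.2, Finset.sum_const, Finset.card_univ,
      Nat.cast_smul_eq_nsmul]
  exact (detects_iff V E).2 ⟨(Fintype.card S : ℂ)⁻¹ * μ, by
    rw [mul_smul, ← hsum, smul_smul, inv_mul_cancel₀ hcard, one_smul]⟩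

/-- The encoder `|p⟩ ↦ W (X p) v` given by displacing a fixed state `v` by Weyl operators. -/
noncomputable def weylEncoder (χ : AddChar A ℂ)
    (X : (Fin k → A) × (Fin c → A) →ₗ[A] (Fin n → A) × (Fin n → A)) (v : (Fin n → A) → ℂ) :
    Matrix (Fin n → A) ((Fin k → A) × (Fin c → A)) ℂ :=
  Matrix.of fun u p => (weyl χ (X p) *ᵥ v) u

variable {X : (Fin k → A) × (Fin c → A) →ₗ[A] (Fin n → A) × (Fin n → A)}
  {M : Submodule A ((Fin n → A) × (Fin n → A))} {v : (Fin n → A) → ℂ}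

lemma weylEncoder_conjTranspose_mul_self (hχ : χ.IsPrimitive) (h2 : (2 : A) ≠ 0)
    (hv : IsStabilized χ M v) (hunit : star v ⬝ᵥ v = 1)
    (hX : ∀ p ≠ 0, ∃ m ∈ M, sympForm m (X p) ≠ 0) :
    (weylEncoder χ X v)ᴴ * weylEncoder χ X v = 1 := by
  ext p p'
  change star (weyl χ (X p) *ᵥ v) ⬝ᵥ (weyl χ (X p') *ᵥ v) = _
  rw [star_weyl_mulVec_dotProduct_weyl_mulVec χ h2, ← map_neg, ← map_add, neg_add_eq_sub]
  rcases eq_or_ne p p' with rfl | hpp'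
  · simp [isAlt_sympForm.self_eq_zero, weyl_zero, hunit]
  · obtain ⟨m, hm, hmX⟩ := hX (p' - p) (sub_ne_zero.2 hpp'.symm)
    rw [star_dotProduct_weyl_mulVec_eq_zero χ hχ h2 hv hm hmX, mul_zero, Matrix.one_apply_ne hpp']

lemma weyl_add_mulVec_weyl_mulVec (h2 : (2 : A) ≠ 0) (hX : ∀ p p', sympForm (X p) (X p') = 0)
    {ρ : (Fin n → A) × (Fin n → A)} (hρ : weyl χ ρ *ᵥ v = v) (p₀ p : (Fin k → A) × (Fin c → A)) :
    weyl χ (ρ + X p₀) *ᵥ (weyl χ (X p) *ᵥ v) =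
      χ (sympForm ρ (X p) + sympForm ρ (X p₀) / 2) • (weyl χ (X (p₀ + p)) *ᵥ v) := by
  have hphase : sympForm (ρ + X p₀) (X p) / 2 =
      sympForm ρ (X p) + sympForm ρ (X p₀) / 2 + sympForm (X (p₀ + p)) ρ / 2 := by
    rw [map_add X, map_add, map_add, LinearMap.add_apply, LinearMap.add_apply, hX,
      ← isAlt_sympForm.neg_eq ρ (X p₀), ← isAlt_sympForm.neg_eq ρ (X p)]
    field_simp
    ring
  have hsplit : weyl χ (ρ + X p₀) * weyl χ (X p) =
      χ (sympForm ρ (X p) + sympForm ρ (X p₀) / 2) • (weyl χ (X (p₀ + p)) * weyl χ ρ) := by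
    rw [weyl_mul χ h2, weyl_mul χ h2, smul_smul, ← AddChar.map_add_eq_mul, hphase, map_add X,
      add_comm (X p₀ + X p), add_assoc ρ]
  rw [Matrix.mulVec_mulVec, hsplit, Matrix.smul_mulVec, ← Matrix.mulVec_mulVec, hρ]

lemma weyl_add_mul_encoderBlock (h2 : (2 : A) ≠ 0) (hX : ∀ p p', sympForm (X p) (X p') = 0)
    {ρ : (Fin n → A) × (Fin n → A)} (hρ : weyl χ ρ *ᵥ v = v)
    (hρX : ∀ l, sympForm ρ (X (l, 0)) = 0) (a : Fin c → A) (b : Fin c → A) :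
    weyl χ (ρ + X (0, a)) * encoderBlock (weylEncoder χ X v) b =
      χ (sympForm ρ (X (0, b)) + sympForm ρ (X (0, a)) / 2) •
        encoderBlock (weylEncoder χ X v) (a + b) := by
  ext u l
  have hcol := congrFun (weyl_add_mulVec_weyl_mulVec h2 hX hρ (0, a) (l, b)) u
  have hsplit : X (l, b) = X (l, 0) + X (0, b) := by rw [← map_add]; simp
  have hphase : sympForm ρ (X (l, b)) = sympForm ρ (X (0, b)) := by
    rw [hsplit, map_add, hρX, zero_add]
  have hidx : ((0, a) + (l, b) : (Fin k → A) × (Fin c → A)) = (l, a + b) := by simp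
  rw [hphase, hidx] at hcol
  exact hcol

lemma weyl_mul_encoderBlock (h2 : (2 : A) ≠ 0) (hX : ∀ p p', sympForm (X p) (X p') = 0)
    (l : Fin k → A) (b : Fin c → A) :
    weyl χ (X (l, 0)) * encoderBlock (weylEncoder χ X v) b =
      (encoderBlock (weylEncoder χ X v) b).submatrix id (l + ·) := by
  ext u l'
  have hcol := congrFun (weyl_add_mulVec_weyl_mulVec (ρ := 0) (v := v) (χ := χ) h2 hX
    (by rw [weyl_zero, Matrix.one_mulVec]) (l, 0) (l', b)) u
  simp only [map_zero, LinearMap.zero_apply, zero_div, add_zero, zero_add,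
    AddChar.map_zero_eq_one, one_smul, Prod.mk_add_mk] at hcol
  exact hcol

/-- The entanglement-assisted stabilizer code of `S`: the encoder displaces a state fixed by the
radical of `S` and by one half of symplectic bases of `S` and `S^⊥`, along the other halves. -/
theorem exists_isEAQECC_of_sympForm (hχ : χ.IsPrimitive) (h2 : (2 : A) ≠ 0) {d : ℕ}
    {S : Submodule A ((Fin n → A) × (Fin n → A))} (hk : 1 ≤ k)
    (hSc : Module.finrank A S = Module.finrank A ↥(S ⊓ sympForm.orthogonal S) + 2 * c)
    (hSk : Module.finrank A (sympForm.orthogonal S) =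
      Module.finrank A ↥(S ⊓ sympForm.orthogonal S) + 2 * k)
    (hd : ∀ z ∈ sympForm.orthogonal S, z ≠ 0 → d ≤ sympWeight z)
    {e : (Fin n → A) × (Fin n → A)} (he : e ∈ sympForm.orthogonal S) (heS : e ∉ S)
    (hed : sympWeight e = d) :
    ∃ V : Matrix (Fin n → A) ((Fin k → A) × (Fin c → A)) ℂ, IsEAQECC n k d c V := by
  obtain ⟨k, rfl⟩ := Nat.exists_eq_add_of_le' hk
  have hω := isAlt_sympForm (A := A) (ι := Fin n)
  have hSS := LinearMap.BilinForm.orthogonal_orthogonal sympForm_nondegenerate hω.isRefl S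
  obtain ⟨xS, yS, hS⟩ := exists_isSymplecticBasis hω hSc
  obtain ⟨xD, yD, hD, rfl⟩ := exists_isSymplecticBasis_left_zero hω
    (by rw [hSS, inf_comm]; exact hSk) he (hSS.symm ▸ heS)
  set X := (Fintype.linearCombination A xD).coprod (Fintype.linearCombination A xS) with hXdef
  have hX : ∀ p p', sympForm (X p) (X p') = 0 := hD.apply_coprod_coprod hω hS le_rfl
  obtain ⟨v, hunit, hv⟩ := exists_isStabilized χ h2 (sup_le_orthogonal_sup hω.isRefl
    (hD.radicalSupSpan_le_orthogonal hω) (hS.radicalSupSpan_le_orthogonal hω)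
    (hD.radicalSupSpan_le.trans (LinearMap.BilinForm.orthogonal_le hS.radicalSupSpan_le)))
  have hV : (weylEncoder χ X v)ᴴ * weylEncoder χ X v = 1 :=
    weylEncoder_conjTranspose_mul_self hχ h2 hv hunit fun p hp =>
      hD.exists_apply_coprod_ne_zero hω hS le_rfl hp
  refine ⟨weylEncoder χ X v, hV, fun T E hT hE => ?_, Finset.univ.filter fun i =>
    ((xD 0).1 i, (xD 0).2 i) ≠ 0, weyl χ (xD 0), hed, actsOn_weyl χ fun i hi => ?_, ?_⟩
  · refine detects_of_partialTrace_weylConj hχ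
      (sup_vanishingOn_eq_top fun z hz hz0 => hT.trans_le (hd z hz hz0))
      (fun z hz => weylConj_eq_of_actsOn χ hE hz) fun z hz => ?_
    obtain ⟨ρ, hρ, a, rfl⟩ := hS.exists_eq_add_linearCombination hz
    have hρX (l) : sympForm ρ (X (l, 0)) = 0 := by
      simpa [hXdef] using hD.linearCombination_mem l ρ (hS.radicalSupSpan_le hρ)
    have hblock := weyl_add_mul_encoderBlock h2 hX (hv ρ (Submodule.mem_sup_right hρ)) hρX a
    rw [show X (0, a) = Fintype.linearCombination A xS a by simp [hXdef]] at hblock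
    exact partialTrace_weylConj (σ := Equiv.addLeft a) hblock E
  · simpa [Prod.ext_iff] using hi
  · have hblock := weyl_mul_encoderBlock (v := v) (χ := χ) h2 hX (Pi.single 0 1)
    rw [show X (Pi.single 0 1, 0) = xD 0 by simp [hXdef]] at hblock
    exact not_detects_of_mul_encoderBlock (l := 0) hV hblock (by simp)

end SymplecticCode

section Hermitian

variable {F ι : Type*} [Field F] [Fintype ι]

/-- The sesquilinear form `∑ i, σ (x i) * y i` on `F^ι`. When `σ` is the involution `x ↦ x ^ q` of
the field with `q ^ 2` elements, it is the Hermitian form with respect to which the dual of a code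
over that field is taken. -/
def hermForm (σ : F →+* F) : (ι → F) →ₛₗ[σ] (ι → F) →ₗ[F] F :=
  LinearMap.mk₂'ₛₗ σ (RingHom.id F) (fun x y => (σ ∘ x) ⬝ᵥ y)
    (fun x x' y => by
      rw [← add_dotProduct]
      exact congrArg (· ⬝ᵥ y) (funext fun i => map_add σ (x i) (x' i)))
    (fun a x y => by
      rw [← smul_dotProduct]
      exact congrArg (· ⬝ᵥ y) (funext fun i => map_mul σ a (x i)))
    (fun x y y' => dotProduct_add _ y y')
    (fun a x y => dotProduct_smul a _ y)

lemma hermForm_apply (σ : F →+* F) (x y : ι → F) : hermForm σ x y = ∑ i, σ (x i) * y i := rfl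

variable {A : Type*} [Field A] [Algebra A F] {σ : F →+* F}

lemma bijective_toSpanSingleton_coprod (h2 : (2 : A) ≠ 0) (hAF : Module.finrank A F = 2)
    (hσA : ∀ a, σ (algebraMap A F a) = algebraMap A F a) {ε : F} (hε : ε ≠ 0) (hσε : σ ε = -ε) :
    Function.Bijective
      ((LinearMap.toSpanSingleton A F 1).coprod (LinearMap.toSpanSingleton A F ε)) := by
  have : FiniteDimensional A F := Module.finite_of_finrank_eq_succ hAF
  have h2F : (2 : F) ≠ 0 := by
    rw [← map_ofNat (algebraMap A F)]
    exact (_root_.map_ne_zero _).2 h2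
  refine (fun h => ⟨h, (LinearMap.injective_iff_surjective_of_finrank_eq_finrank (by simp [hAF])).1
    h⟩) ((injective_iff_map_eq_zero _).2 fun ⟨a, b⟩ hab => ?_)
  simp only [LinearMap.coprod_apply, LinearMap.toSpanSingleton_apply, Algebra.smul_def,
    mul_one] at hab
  have hconj := congrArg σ hab
  rw [map_add, map_mul, hσA, hσA, hσε, map_zero] at hconj
  have ha : algebraMap A F a = 0 := by
    refine (mul_eq_zero.1 (?_ : 2 * algebraMap A F a = 0)).resolve_left h2F
    linear_combination hab + hconj
  have hb : algebraMap A F b = 0 := by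
    rw [ha, zero_add] at hab
    exact (mul_eq_zero.1 hab).resolve_right hε
  exact Prod.ext ((map_eq_zero _).1 ha) ((map_eq_zero _).1 hb)

/-- Write `x = a + b * ε` and `y = a' + b' * ε`: as `ε ^ 2` is in `A`, the `ε`-coordinate of
`σ x * y` is `a * b' - b * a'`. -/
lemma exists_linearEquiv_prod (h2 : (2 : A) ≠ 0) (hAF : Module.finrank A F = 2)
    (hσA : ∀ a, σ (algebraMap A F a) = algebraMap A F a) {ε : F} (hε : ε ≠ 0) (hσε : σ ε = -ε) :
    ∃ (e : F ≃ₗ[A] A × A) (φ : F →ₗ[A] A), φ ≠ 0 ∧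
      ∀ x y, (e x).2 * (e y).1 - (e x).1 * (e y).2 = φ (σ x * y) := by
  set f := LinearEquiv.ofBijective _ (bijective_toSpanSingleton_coprod h2 hAF hσA hε hσε) with hf
  have hf_apply p : f p = algebraMap A F p.1 + algebraMap A F p.2 * ε := by
    simp [hf, Algebra.smul_def]
  obtain ⟨⟨u, v⟩, huv⟩ := f.surjective (ε ^ 2)
  have hv : v = 0 := by
    have hconj : f (u, v) = f (u, -v) := by
      have h := congrArg σ huv
      rw [hf_apply, map_add, map_mul, hσA, hσA, hσε, map_pow, hσε, neg_sq, ← huv] at h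
      rw [← h, hf_apply, map_neg, neg_mul, mul_neg]
    have h2v : 2 * v = 0 := by linear_combination (Prod.ext_iff.1 (f.injective hconj)).2
    exact (mul_eq_zero.1 h2v).resolve_left h2
  have hu : ε ^ 2 = algebraMap A F u := by rw [← huv, hf_apply, hv, map_zero, zero_mul, add_zero]
  have hmul p p' : σ (f p) * f p' = f (p.1 * p'.1 - p.2 * p'.2 * u, p.1 * p'.2 - p.2 * p'.1) := by
    simp only [hf_apply, map_add, map_sub, map_mul, hσA, hσε, ← hu]
    ring
  refine ⟨f.symm, -(LinearMap.snd A A A ∘ₗ f.symm), fun h => ?_, fun x y => ?_⟩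
  · simpa using LinearMap.congr_fun h (f (0, 1))
  · obtain ⟨p, rfl⟩ := f.surjective x
    obtain ⟨p', rfl⟩ := f.surjective y
    simp [hmul]

/-- The symplectic coordinates of a Hermitian space: taken coordinatewise, the two coordinates of
`exists_linearEquiv_prod` turn the Hermitian form into the standard symplectic form. -/
lemma exists_linearEquiv_sympForm [DecidableEq A] [DecidableEq F] (h2 : (2 : A) ≠ 0)
    (hAF : Module.finrank A F = 2) (hσA : ∀ a, σ (algebraMap A F a) = algebraMap A F a) {ε : F}
    (hε : ε ≠ 0) (hσε : σ ε = -ε) :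
    ∃ (ν : (ι → F) ≃ₗ[A] (ι → A) × (ι → A)) (φ : F →ₗ[A] A), φ ≠ 0 ∧
      (∀ x y, sympForm (ν x) (ν y) = φ (hermForm σ x y)) ∧
      ∀ x, sympWeight (ν x) = hammingNorm x := by
  obtain ⟨e, φ, hφ, he⟩ := exists_linearEquiv_prod h2 hAF hσA hε hσε
  refine ⟨{ toFun := fun x => (fun i => (e (x i)).1, fun i => (e (x i)).2)
            invFun := fun z i => e.symm (z.1 i, z.2 i)
            map_add' := fun x y => by ext <;> simp
            map_smul' := fun a x => by ext <;> simp
            left_inv := fun x => by simp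
            right_inv := fun z => by simp }, φ, hφ, fun x y => ?_, fun x => ?_⟩
  · simp only [sympForm_apply, hermForm_apply, map_sum, dotProduct, ← Finset.sum_sub_distrib, ← he]
    rfl
  · exact hammingNorm_comp (fun _ => e) (fun _ => e.injective) fun _ => map_zero e

lemma sympForm_orthogonal_map {ν : (ι → F) ≃ₗ[A] (ι → A) × (ι → A)} {φ : F →ₗ[A] A} (hφ : φ ≠ 0)
    (hν : ∀ x y, sympForm (ν x) (ν y) = φ (hermForm σ x y)) (hσ : Function.Surjective σ)
    (D : Submodule F (ι → F)) :
    sympForm.orthogonal ((D.restrictScalars A).map (ν : (ι → F) →ₗ[A] (ι → A) × (ι → A))) =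
      ((D.orthogonalBilin (hermForm σ)).restrictScalars A).map
        (ν : (ι → F) →ₗ[A] (ι → A) × (ι → A)) := by
  ext z
  obtain ⟨y, rfl⟩ := ν.surjective z
  rw [Submodule.mem_map_equiv, ν.symm_apply_apply, Submodule.restrictScalars_mem,
    Submodule.mem_orthogonalBilin_iff, LinearMap.BilinForm.mem_orthogonal_iff]
  constructor
  · intro h x hx
    by_contra hne
    obtain ⟨b, hb⟩ := DFunLike.ne_iff.1 hφ
    obtain ⟨a, ha⟩ := hσ (b / hermForm σ x y)
    refine hb ?_
    have hax := (hν (a • x) y).symm.trans (h _ (Submodule.mem_map_of_mem (D.smul_mem a hx)))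
    rwa [LinearMap.map_smulₛₗ, LinearMap.smul_apply, ha, smul_eq_mul,
      div_mul_cancel₀ _ hne] at hax
  · rintro h _ ⟨x, hx, rfl⟩
    exact (hν x y).trans (by rw [h x hx, map_zero])

lemma finrank_map_restrictScalars {U W : Type*} [AddCommGroup U] [Module F U] [Module A U]
    [IsScalarTower A F U] [AddCommGroup W] [Module A W] (hAF : Module.finrank A F = 2)
    (ν : U ≃ₗ[A] W) (D : Submodule F U) :
    Module.finrank A ((D.restrictScalars A).map (ν : U →ₗ[A] W)) =
      2 * Module.finrank F D := by
  rw [LinearEquiv.finrank_map_eq, ← hAF, Module.finrank_mul_finrank A F D]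
  rfl

/-- The entanglement-assisted quantum code of a code `D` over a quadratic extension: in symplectic
coordinates, this is the entanglement-assisted stabilizer code of the Hermitian dual. -/
theorem exists_isEAQECC_of_hermForm [Fintype A] [DecidableEq A] [DecidableEq F]
    {n k c d : ℕ} (h2 : (2 : A) ≠ 0) (hAF : Module.finrank A F = 2)
    (hσA : ∀ a, σ (algebraMap A F a) = algebraMap A F a) (hσ : Function.Surjective σ) {ε : F}
    (hε : ε ≠ 0) (hσε : σ ε = -ε) {D : Submodule F (Fin n → F)} (hk : 1 ≤ k)
    (hDk : Module.finrank F D =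
      Module.finrank F ↥(D ⊓ D.orthogonalBilin (hermForm σ)) + k)
    (hDc : Module.finrank F (D.orthogonalBilin (hermForm σ)) =
      Module.finrank F ↥(D ⊓ D.orthogonalBilin (hermForm σ)) + c)
    (hd : ∀ x ∈ D, x ≠ 0 → d ≤ hammingNorm x) {e : Fin n → F} (he : e ∈ D)
    (heD : e ∉ D.orthogonalBilin (hermForm σ)) (hed : hammingNorm e = d) :
    ∃ V : Matrix (Fin n → A) ((Fin k → A) × (Fin c → A)) ℂ, IsEAQECC n k d c V := by
  obtain ⟨ν, φ, hφ, hν, hweight⟩ := exists_linearEquiv_sympForm (ι := Fin n) h2 hAF hσA hε hσε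
  have horth := sympForm_orthogonal_map hφ hν hσ D
  let f : (Fin n → F) →ₗ[A] (Fin n → A) × (Fin n → A) := ν.toLinearMap
  have hSS := LinearMap.BilinForm.orthogonal_orthogonal sympForm_nondegenerate
    isAlt_sympForm.isRefl ((D.restrictScalars A).map f)
  rw [horth] at hSS
  have hinf : Module.finrank A ↥(((D.orthogonalBilin (hermForm σ)).restrictScalars A).map f ⊓
      (D.restrictScalars A).map f) =
      2 * Module.finrank F ↥(D ⊓ D.orthogonalBilin (hermForm σ)) := by
    rw [← Submodule.map_inf _ ν.injective, inf_comm, ← finrank_map_restrictScalars hAF ν]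
    rfl
  refine exists_isEAQECC_of_sympForm (AddChar.FiniteField.primitiveChar_to_Complex_isPrimitive A)
    h2 hk (S := ((D.orthogonalBilin (hermForm σ)).restrictScalars A).map f) (e := ν e)
    ?_ ?_ ?_ ?_ ?_ ?_
  · rw [hSS, hinf, finrank_map_restrictScalars hAF, hDc, mul_add]
  · rw [hSS, hinf, finrank_map_restrictScalars hAF, hDk, mul_add]
  · rw [hSS]
    rintro _ ⟨x, hx, rfl⟩ hx0
    exact (hd x hx fun h => hx0 (by rw [h, map_zero])).trans_eq (hweight x).symm
  · rw [hSS]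
    exact Submodule.mem_map_of_mem he
  · rw [Submodule.mem_map_equiv, ν.symm_apply_apply]
    exact heD
  · rw [hweight, hed]

end Hermitian

section QuadraticExtension

variable {F : Type*} [Field F] [Fintype F] {q : ℕ}

lemma exists_eq_prime_pow (hF : Fintype.card F = q ^ 2) :
    ∃ p e : ℕ, p.Prime ∧ CharP F p ∧ e ≠ 0 ∧ q = p ^ e := by
  obtain ⟨p, hchar⟩ := CharP.exists F
  obtain ⟨k, hp, hk⟩ := FiniteField.card F p
  obtain ⟨e, -, he⟩ := (Nat.dvd_prime_pow hp).1 ((dvd_pow_self q two_ne_zero).trans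
    (dvd_of_eq (hF.symm.trans hk)))
  refine ⟨p, e, hp, hchar, ?_, he⟩
  rintro rfl
  have hlt := Fintype.one_lt_card (α := F)
  simp [hF, he] at hlt

lemma exists_field_fin (hF : Fintype.card F = q ^ 2) :
    ∃ _ : Field (Fin q), Nonempty (Fin q →+* F) := by
  obtain ⟨p, e, hp, hchar, he, rfl⟩ := exists_eq_prime_pow hF
  have := Fact.mk hp
  let : Algebra (ZMod p) F := ZMod.algebra F p
  have hcard : Nat.card (GaloisField p e) = p ^ e := GaloisField.card p e he
  have hfinrank : Module.finrank (ZMod p) F = e * 2 := by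
    have h := FiniteField.pow_finrank_eq_card p F
    rw [hF, ← pow_mul] at h
    exact Nat.pow_right_injective hp.two_le h
  obtain ⟨f⟩ := FiniteField.nonempty_algHom_of_finrank_dvd (F := ZMod p)
    (K := GaloisField p e) (L := F) (by
      rw [hfinrank, GaloisField.finrank p he]
      exact dvd_mul_right _ _)
  have : Finite (GaloisField p e) := Nat.finite_of_card_ne_zero (by
    rw [hcard]
    exact pow_ne_zero _ hp.ne_zero)
  have equiv : Fin (p ^ e) ≃ GaloisField p e :=
    (finCongr hcard.symm).trans (Finite.equivFin (GaloisField p e)).symm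
  let : Field (Fin (p ^ e)) := equiv.field
  exact ⟨inferInstance,
    ⟨f.toRingHom.comp (equiv.ringEquiv : Fin (p ^ e) →+* GaloisField p e)⟩⟩

lemma exists_ringHom_eq_pow (hF : Fintype.card F = q ^ 2) (K : Type*) [Field K] [Algebra F K] :
    ∃ τ : K →+* K, ∀ x, τ x = x ^ q := by
  obtain ⟨p, e, hp, hchar, -, rfl⟩ := exists_eq_prime_pow hF
  have := Fact.mk hp
  have := charP_of_injective_algebraMap (algebraMap F K).injective p
  exact ⟨iterateFrobenius K p e, iterateFrobenius_def p e⟩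

variable {σ : F →+* F}

lemma apply_apply_eq_self_of_eq_pow (hF : Fintype.card F = q ^ 2) (hσ : ∀ x, σ x = x ^ q) (x : F) :
    σ (σ x) = x := by
  rw [hσ, hσ, ← pow_mul, ← sq, ← hF, FiniteField.pow_card]

lemma exists_ne_zero_apply_eq_neg (hF : Fintype.card F = q ^ 2) (hσ : ∀ x, σ x = x ^ q) :
    ∃ ε ≠ 0, σ ε = -ε := by
  have hq : 1 < q ^ 2 := hF ▸ Fintype.one_lt_card
  have hq1 : 1 < q := by nlinarith
  obtain ⟨u, hu⟩ : ∃ u : Fˣ, u ^ (q - 1) ≠ 1 := by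
    refine IsCyclic.exists_ofOrder_eq_natCard.imp fun u hu h => ?_
    have hle := Nat.le_of_dvd (by omega) (orderOf_dvd_of_pow_eq_one h)
    rw [hu, Nat.card_units, Nat.card_eq_fintype_card, hF] at hle
    have : q < q ^ 2 := by nlinarith
    omega
  refine ⟨u - σ u, fun h => hu ?_, by rw [map_sub, apply_apply_eq_self_of_eq_pow hF hσ, neg_sub]⟩
  ext
  have hu' : (u : F) ^ (q - 1) * u = u := by
    rw [← pow_succ, Nat.sub_add_cancel hq1.le, ← hσ]
    exact (sub_eq_zero.1 h).symm
  simpa using hu'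

theorem existsEAQECC_of_hermForm [DecidableEq F] {n k c d : ℕ} (hF : Fintype.card F = q ^ 2)
    (hq : Odd q) (hσ : ∀ x, σ x = x ^ q) {D : Submodule F (Fin n → F)} (hk : 1 ≤ k)
    (hDk : Module.finrank F D =
      Module.finrank F ↥(D ⊓ D.orthogonalBilin (hermForm σ)) + k)
    (hDc : Module.finrank F (D.orthogonalBilin (hermForm σ)) =
      Module.finrank F ↥(D ⊓ D.orthogonalBilin (hermForm σ)) + c)
    (hd : ∀ x ∈ D, x ≠ 0 → d ≤ hammingNorm x) {e : Fin n → F} (he : e ∈ D)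
    (heD : e ∉ D.orthogonalBilin (hermForm σ)) (hed : hammingNorm e = d) :
    ExistsEAQECC q n k d c := by
  obtain ⟨_, ⟨f⟩⟩ := exists_field_fin hF
  let _ : Algebra (Fin q) F := f.toAlgebra
  have h2 : (2 : Fin q) ≠ 0 := Ring.two_ne_zero fun h => by
    rw [FiniteField.even_card_iff_char_two, Fintype.card_fin] at h
    exact (Nat.not_even_iff_odd.2 hq) (Nat.even_iff.2 h)
  have hAF : Module.finrank (Fin q) F = 2 := by
    have h := Module.card_eq_pow_finrank (K := Fin q) (V := F)
    rw [Fintype.card_fin, hF] at h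
    exact (Nat.pow_right_injective (Fintype.card_fin q ▸ Fintype.one_lt_card (α := Fin q)) h).symm
  have hσA (a : Fin q) : σ (algebraMap (Fin q) F a) = algebraMap (Fin q) F a := by
    rw [hσ, ← map_pow]
    congr 1
    simpa using FiniteField.pow_card a
  obtain ⟨ε, hε, hσε⟩ := exists_ne_zero_apply_eq_neg hF hσ
  exact ⟨hk, exists_isEAQECC_of_hermForm h2 hAF hσA
    (Function.RightInverse.surjective (apply_apply_eq_self_of_eq_pow hF hσ)) hε hσε hk hDk hDc hd
    he heD hed⟩

end QuadraticExtension

section LinearCode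

variable {F ι : Type*} [Field F] [Fintype ι]

lemma hermForm_injective (σ : F →+* F) : Function.Injective (hermForm (ι := ι) σ) := by
  classical
  refine (injective_iff_map_eq_zero _).2 fun x hx => funext fun i => ?_
  have h := LinearMap.congr_fun hx (Pi.single i 1)
  simpa [hermForm_apply, Pi.single_apply] using h

lemma finrank_add_finrank_orthogonalBilin_hermForm {σ : F →+* F} (hσ : Function.Bijective σ)
    (D : Submodule F (ι → F)) :
    Module.finrank F D + Module.finrank F (D.orthogonalBilin (hermForm σ)) = Fintype.card ι := by
  have := RingHomSurjective.mk hσ.2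
  have hmap : Module.finrank F (D.map (hermForm σ)) = Module.finrank F D := by
    set τ := RingEquiv.ofBijective σ hσ
    have : RingHomInvPair σ (τ.symm : F →+* F) :=
      ⟨RingHom.ext τ.symm_apply_apply, RingHom.ext τ.apply_symm_apply⟩
    have : RingHomInvPair (τ.symm : F →+* F) σ := RingHomInvPair.symm _ _
    let e := Submodule.equivMapOfInjective (hermForm σ) (hermForm_injective σ) D
    exact congrArg Cardinal.toNat (rank_eq_of_equiv_equiv σ e.toAddEquiv hσ e.map_smulₛₗ).symm
  have horth : D.orthogonalBilin (hermForm σ) = (D.map (hermForm σ)).dualCoannihilator := by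
    ext y
    simp [Submodule.mem_dualCoannihilator]
  rw [horth, ← hmap, Subspace.finrank_add_finrank_dualCoannihilator_eq,
    Module.finrank_fintype_fun_eq_card]

lemma exists_ne_zero_forall_notMem_eq_zero {D : Submodule F (ι → F)} {S : Finset ι}
    (h : Fintype.card ι < Module.finrank F D + S.card) :
    ∃ x ∈ D, x ≠ 0 ∧ ∀ i ∉ S, x i = 0 := by
  classical
  have hker := LinearMap.ker_ne_bot_of_finrank_lt (f := LinearMap.funLeft F F
    (Subtype.val : ↥Sᶜ → ι) ∘ₗ D.subtype) (by
      rw [Module.finrank_fintype_fun_eq_card, Fintype.card_coe, Finset.card_compl]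
      have := Finset.card_le_univ S
      omega)
  obtain ⟨x, hx, hx0⟩ := Submodule.exists_mem_ne_zero_of_ne_bot hker
  exact ⟨x, x.2, fun h => hx0 (Subtype.ext h), fun i hi =>
    congrFun (LinearMap.mem_ker.1 hx) ⟨i, Finset.mem_compl.2 hi⟩⟩

/-- Subtracting multiples of words of weight `d` supported inside the support of `x` lowers the
weight of `x` until nothing is left. -/
lemma le_of_forall_hammingNorm_eq_mem [DecidableEq F] {D E : Submodule F (ι → F)} {d : ℕ}
    (hD : Fintype.card ι + 1 = Module.finrank F D + d) (hd : ∀ x ∈ D, x ≠ 0 → d ≤ hammingNorm x)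
    (hE : ∀ x ∈ D, hammingNorm x = d → x ∈ E) : D ≤ E := by
  classical
  intro x hx
  induction hw : hammingNorm x using Nat.strong_induction_on generalizing x with
  | _ w ih =>
    rcases eq_or_ne x 0 with rfl | hx0
    · exact E.zero_mem
    obtain ⟨S, hS, hSd⟩ := Finset.exists_subset_card_eq (hd x hx hx0)
    obtain ⟨e, he, he0, heS⟩ :=
      exists_ne_zero_forall_notMem_eq_zero (D := D) (S := S) (by omega)
    have hesupp : ({i | e i ≠ 0} : Finset ι) ⊆ S := fun i hi => by
      by_contra hiS
      exact (Finset.mem_filter.1 hi).2 (heS i hiS)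
    have hed : hammingNorm e = d :=
      ((Finset.card_le_card hesupp).trans_eq hSd).antisymm (hd e he he0)
    obtain ⟨i, hi⟩ := Function.ne_iff.1 he0
    have hxi : x i ≠ 0 := (Finset.mem_filter.1 (hS (hesupp (by simpa using hi)))).2
    have hlt : hammingNorm (x - (x i / e i) • e) < w := by
      rw [← hw]
      refine Finset.card_lt_card ⟨fun j hj => ?_, fun h => ?_⟩
      · by_contra hxj
        refine (Finset.mem_filter.1 hj).2 ?_
        have hej : e j = 0 := heS j fun hjS => hxj (hS hjS)
        simp_all
      · have hmem := h (Finset.mem_filter.2 ⟨Finset.mem_univ i, hxi⟩)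
        simp [div_mul_cancel₀ _ hi] at hmem
    have hsub := ih _ hlt (D.sub_mem hx (D.smul_mem _ he)) rfl
    simpa using E.add_mem hsub (E.smul_mem (x i / e i) (hE e he hed))

end LinearCode

section FrobeniusDescent

variable {F K : Type*} [Field F] [Fintype F] [Field K] [Algebra F K]

lemma mem_range_algebraMap_of_pow_card {x : K} (hx : x ^ Fintype.card F = x) :
    x ∈ (algebraMap F K).range := by
  have hsplits : (X ^ Fintype.card F - X : F[X]).Splits := by
    rw [splits_iff_card_roots, FiniteField.roots_X_pow_card_sub_X,
      FiniteField.X_pow_card_sub_X_natDegree_eq F Fintype.one_lt_card, Finset.card_val,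
      Finset.card_univ]
  have hroot : x ∈ ((X ^ Fintype.card F - X : F[X]).map (algebraMap F K)).roots := by
    rw [Polynomial.map_sub, Polynomial.map_pow, map_X,
      mem_roots (FiniteField.X_pow_card_sub_X_ne_zero K Fintype.one_lt_card)]
    simp [hx]
  rw [hsplits.roots_map] at hroot
  obtain ⟨y, -, hy⟩ := Multiset.mem_map.1 hroot
  exact ⟨y, hy⟩

lemma image_frobenius_eq [DecidableEq K] {Z : Finset K} (hZ : ∀ z ∈ Z, z ^ Fintype.card F ∈ Z) :
    Z.image (FiniteField.frobeniusAlgHom F K) = Z :=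
  Finset.eq_of_subset_of_card_le (Finset.image_subset_iff.2 hZ)
    (Finset.card_image_of_injective _ (FiniteField.frobeniusAlgHom F K).injective).ge

lemma exists_monic_map_eq_prod_X_sub_C {Z : Finset K} (hZ : ∀ z ∈ Z, z ^ Fintype.card F ∈ Z) :
    ∃ g : F[X], g.Monic ∧ g.map (algebraMap F K) = ∏ z ∈ Z, (X - C z) := by
  classical
  have hfixed : (∏ z ∈ Z, (X - C z)).map (FiniteField.frobeniusAlgHom F K : K →+* K) =
      ∏ z ∈ Z, (X - C z) := by
    conv_rhs => rw [← image_frobenius_eq hZ,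
      Finset.prod_image (g := FiniteField.frobeniusAlgHom F K) (RingHom.injective _).injOn]
    simp [Polynomial.map_prod]
  have hlifts : ∏ z ∈ Z, (X - C z) ∈ lifts (algebraMap F K) := by
    rw [lifts_iff_coeff_lifts]
    refine fun i => mem_range_algebraMap_of_pow_card ?_
    conv_rhs => rw [← hfixed, coeff_map]
    rfl
  obtain ⟨g, hg, -, hgmonic⟩ := lifts_and_degree_eq_and_monic hlifts
    (monic_prod_of_monic _ _ fun z _ => monic_X_sub_C z)
  exact ⟨g, hgmonic, hg⟩

end FrobeniusDescent

section VanishingCode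

variable {F K : Type*} [Field F] [Field K] [Algebra F K] {n : ℕ}

/-- `wordPoly` as a linear map. -/
noncomputable def wordPolyₗ : (Fin n → F) →ₗ[F] F[X] :=
  ∑ i : Fin n, monomial (i : ℕ) ∘ₗ LinearMap.proj i

lemma wordPolyₗ_apply (c : Fin n → F) : wordPolyₗ c = wordPoly c := by
  simp [wordPolyₗ, wordPoly, C_mul_X_pow_eq_monomial]

lemma aeval_wordPoly (z : K) (c : Fin n → F) :
    aeval z (wordPoly c) = ∑ i, algebraMap F K (c i) * z ^ (i : ℕ) := by
  simp [wordPoly]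

lemma exists_wordPoly_eq {p : F[X]} (hp : p.degree < n) : ∃ c : Fin n → F, wordPoly c = p := by
  refine ⟨fun i => p.coeff i, ?_⟩
  rw [wordPoly, Polynomial.sum_fin (fun i a => C a * X ^ i) (by simp) hp, sum_C_mul_X_pow_eq]

variable (F n) in
/-- The words whose polynomial vanishes on `Z`. For a Frobenius-closed set `Z` of roots of
`X ^ n - α`, this is the `α`-constacyclic code with zeros `Z`. -/
noncomputable def vanishingCode (Z : Finset K) : Submodule F (Fin n → F) :=
  ⨅ z ∈ Z, LinearMap.ker ((aeval z).toLinearMap ∘ₗ wordPolyₗ)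

lemma mem_vanishingCode {Z : Finset K} {c : Fin n → F} :
    c ∈ vanishingCode F n Z ↔ ∀ z ∈ Z, aeval z (wordPoly c) = 0 := by
  simp [vanishingCode, Submodule.mem_iInf, wordPolyₗ_apply]

lemma vanishingCode_inf_vanishingCode [DecidableEq K] (Z W : Finset K) :
    vanishingCode F n Z ⊓ vanishingCode F n W = vanishingCode F n (Z ∪ W) := by
  ext c
  simp only [Submodule.mem_inf, mem_vanishingCode, Finset.forall_mem_union]

lemma prod_X_sub_C_dvd_iff {Z : Finset K} {p : K[X]} :
    ∏ z ∈ Z, (X - C z) ∣ p ↔ ∀ z ∈ Z, p.IsRoot z := by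
  rcases eq_or_ne p 0 with rfl | hp
  · simp
  · rw [← Finset.prod_map_val, Multiset.prod_X_sub_C_dvd_iff_le_roots hp,
      Multiset.le_iff_subset Z.nodup]
    exact forall₂_congr fun z _ => mem_roots hp

lemma dvd_iff_of_map_eq_prod {Z : Finset K} {g p : F[X]}
    (hg : g.map (algebraMap F K) = ∏ z ∈ Z, (X - C z)) :
    g ∣ p ↔ ∀ z ∈ Z, aeval z p = 0 := by
  rw [← map_dvd_map' (algebraMap F K), hg, prod_X_sub_C_dvd_iff]
  simp only [IsRoot.def, eval_map_algebraMap]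

lemma mem_vanishingCode_iff_dvd {Z : Finset K} {g : F[X]}
    (hg : g.map (algebraMap F K) = ∏ z ∈ Z, (X - C z)) {c : Fin n → F} :
    c ∈ vanishingCode F n Z ↔ g ∣ wordPoly c := by
  rw [mem_vanishingCode, dvd_iff_of_map_eq_prod hg]

lemma finrank_vanishingCode_add_card [Fintype F] {Z : Finset K}
    (hZ : ∀ z ∈ Z, z ^ Fintype.card F ∈ Z) (hZn : Z.card ≤ n) :
    Module.finrank F (vanishingCode F n Z) + Z.card = n := by
  obtain ⟨g, hgmonic, hg⟩ := exists_monic_map_eq_prod_X_sub_C hZ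
  have hdeg : g.natDegree = Z.card := by
    rw [← natDegree_map (algebraMap F K), hg, natDegree_finsetProd_X_sub_C_eq_card]
  set f : (Fin n → F) →ₗ[F] AdjoinRoot g := (AdjoinRoot.mkₐ g).toLinearMap ∘ₗ wordPolyₗ
  have hker : LinearMap.ker f = vanishingCode F n Z := by
    ext c
    rw [mem_vanishingCode_iff_dvd hg, ← wordPolyₗ_apply]
    exact AdjoinRoot.mk_eq_zero
  have hrange : LinearMap.range f = ⊤ := by
    refine LinearMap.range_eq_top.2 fun x => ?_
    obtain ⟨p, rfl⟩ := AdjoinRoot.mk_surjective x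
    have hlt : (p %ₘ g).degree < n := by
      refine (degree_modByMonic_lt p hgmonic).trans_le ?_
      rw [degree_eq_natDegree hgmonic.ne_zero, hdeg]
      exact_mod_cast hZn
    obtain ⟨c, hc⟩ := exists_wordPoly_eq hlt
    refine ⟨c, ?_⟩
    change AdjoinRoot.mk g (wordPolyₗ c) = _
    rw [wordPolyₗ_apply, hc, AdjoinRoot.mk_eq_mk]
    exact dvd_modByMonic_sub p g
  have hfin : Module.finrank F (AdjoinRoot g) = Z.card := by
    rw [← hdeg]
    exact finrank_quotient_span_eq_natDegree
  rw [← hker, ← hfin, ← finrank_top F (AdjoinRoot g), ← hrange, add_comm,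
    LinearMap.finrank_range_add_finrank_ker, Module.finrank_fin_fun]

/-- The BCH bound: a word of weight at most `m` vanishing at `a, aβ, …, aβ^(m-1)` gives a
singular Vandermonde system. -/
lemma lt_hammingNorm_of_mem_vanishingCode [DecidableEq F] {β : K} (hβ : IsPrimitiveRoot β n)
    {a : K} (ha : a ≠ 0) {m : ℕ} {Z : Finset K} (hZ : ∀ l < m, a * β ^ l ∈ Z) {c : Fin n → F}
    (hc : c ∈ vanishingCode F n Z) (hc0 : c ≠ 0) : m < hammingNorm c := by
  by_contra! hle
  let S : Finset (Fin n) := {i | c i ≠ 0}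
  let s : Fin S.card ≃ S := S.equivFin.symm
  have hinj : Function.Injective fun i => β ^ (s i : ℕ) := fun i j h =>
    s.injective (Subtype.ext (Fin.ext (hβ.pow_inj (s i : Fin n).isLt (s j : Fin n).isLt h)))
  have hzero := Matrix.eq_zero_of_forall_pow_sum_mul_pow_eq_zero
    (v := fun i => algebraMap F K (c (s i)) * a ^ (s i : ℕ)) hinj fun l => by
      have h := mem_vanishingCode.1 hc _ (hZ l (l.isLt.trans_le hle))
      rw [aeval_wordPoly, ← Finset.sum_subset (Finset.subset_univ S) (by simp +contextual [S]),
        ← Finset.sum_coe_sort, ← s.sum_comp] at h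
      rw [← h]
      exact Finset.sum_congr rfl fun i _ => by rw [mul_pow, pow_right_comm, mul_assoc]
  obtain ⟨i, hi⟩ := Function.ne_iff.1 hc0
  have hiS := congrFun hzero (s.symm ⟨i, by simpa [S] using hi⟩)
  simp only [Equiv.apply_symm_apply, Pi.zero_apply, mul_eq_zero, map_eq_zero, pow_eq_zero_iff',
    ha, false_and, or_false] at hiS
  exact hi hiS

end VanishingCode

section Constacyclic

variable {F K : Type*} [Field F] [Field K] [Algebra F K] {n : ℕ}

lemma aeval_wordPoly_constacyclicShift {α : F} {z : K} (hz : z ^ n = algebraMap F K α)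
    (c : Fin n → F) :
    aeval z (wordPoly (constacyclicShift α c)) = z * aeval z (wordPoly c) := by
  cases n with
  | zero => simp [wordPoly]
  | succ n =>
    rw [aeval_wordPoly, aeval_wordPoly, Fin.sum_univ_succ, Fin.sum_univ_castSucc, mul_add,
      Finset.mul_sum, add_comm]
    congr 1
    · refine Finset.sum_congr rfl fun i _ => ?_
      rw [Fin.val_succ, Fin.val_castSucc, pow_succ', mul_left_comm]
      rfl
    · simp only [constacyclicShift, Fin.val_zero, if_true, map_mul, ← hz, Fin.val_last, pow_zero]
      rw [pow_succ', mul_one, mul_comm, mul_left_comm]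
      rfl

lemma isConstacyclic_vanishingCode {α : F} {Z : Finset K}
    (hZ : ∀ z ∈ Z, z ^ n = algebraMap F K α) : IsConstacyclic α (vanishingCode F n Z) := by
  intro c hc
  rw [mem_vanishingCode] at hc ⊢
  intro z hz
  rw [aeval_wordPoly_constacyclicShift (hZ z hz), hc z hz, mul_zero]

variable {r : ℕ} {δ : K}

lemma pow_val_eq_zpow_of_intCast_eq {N : ℕ} [NeZero N] (hδ : IsPrimitiveRoot δ N) {x : ZMod N}
    {a : ℤ} (h : (a : ZMod N) = x) : δ ^ x.val = δ ^ a := by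
  have hδ0 : δ ≠ 0 := hδ.ne_zero NeZero.out
  have hmod : (a : ZMod N) = ((x.val : ℤ) : ZMod N) := by
    rw [h, Int.cast_natCast, ZMod.natCast_rightInverse x]
  rw [ZMod.intCast_eq_intCast_iff_dvd_sub, ← hδ.zpow_eq_one_iff_dvd, zpow_sub₀ hδ0,
    div_eq_one_iff_eq (zpow_ne_zero _ hδ0), zpow_natCast] at hmod
  exact hmod

lemma pow_val_pow_eq_of_mem_rootExponents [NeZero (r * n)] (hδ : IsPrimitiveRoot δ (r * n))
    {i : ZMod (r * n)} (hi : i ∈ rootExponents r n) : (δ ^ i.val) ^ n = δ ^ n := by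
  obtain ⟨j, -, rfl⟩ := hi
  rw [pow_val_eq_zpow_of_intCast_eq hδ (a := (1 + r * j : ℕ)) (by push_cast; rfl), zpow_natCast,
    ← pow_mul, show (1 + r * j) * n = n + r * n * j by ring, pow_add, pow_mul _ (r * n),
    hδ.pow_eq_one, one_pow, mul_one]

theorem isConstacyclicWithDefiningSet_vanishingCode [Fintype F] [NeZero (r * n)] {α : F}
    (hδ : IsPrimitiveRoot δ (r * n)) (hδα : δ ^ n = algebraMap F K α) {T : Set (ZMod (r * n))}
    (hT : T ⊆ rootExponents r n) {Z : Finset K} (hZT : (Z : Set K) = (fun i => δ ^ i.val) '' T)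
    (hZ : ∀ z ∈ Z, z ^ Fintype.card F ∈ Z) :
    IsConstacyclicWithDefiningSet r n α δ (vanishingCode F n Z) T := by
  have hZα z (hz : z ∈ Z) : z ^ n = algebraMap F K α := by
    obtain ⟨i, hi, rfl⟩ := hZT.subset hz
    rw [pow_val_pow_eq_of_mem_rootExponents hδ (hT hi), hδα]
  obtain ⟨g, hgmonic, hg⟩ := exists_monic_map_eq_prod_X_sub_C hZ
  refine ⟨isConstacyclic_vanishingCode hZα, g, ⟨hgmonic, ?_, fun c =>
    mem_vanishingCode_iff_dvd hg⟩, ?_⟩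
  · rw [dvd_iff_of_map_eq_prod hg]
    intro z hz
    simp [hZα z hz]
  · have hroot i : aeval (δ ^ i.val) g = 0 ↔ i ∈ T := by
      have hinj : Function.Injective fun i : ZMod (r * n) => δ ^ i.val := fun i j h =>
        ZMod.val_injective _ (hδ.pow_inj (ZMod.val_lt i) (ZMod.val_lt j) h)
      rw [← hinj.mem_set_image (s := T), ← hZT, ← eval_map_algebraMap, hg, eval_prod,
        Finset.prod_eq_zero_iff]
      simp [sub_eq_zero]
    ext i
    simp only [definingSet, Set.mem_ofPred_eq, hroot]
    exact and_iff_right_of_imp fun hi => hT hi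

end Constacyclic

section HermitianDual

variable {K : Type*} [Field K] {n q : ℕ} {β ω a : K}

lemma card_nthRootsFinset_of_isPrimitiveRoot (hβ : IsPrimitiveRoot β n) (hω : ω ^ n = a)
    (ha : a ≠ 0) : (nthRootsFinset n a).card = n := by
  classical
  rw [nthRootsFinset_def, Multiset.toFinset_card_of_nodup (hβ.nthRoots_nodup ha),
    hβ.card_nthRoots, if_pos ⟨ω, hω⟩]

/-- The map `z ↦ z ^ (-q)`, which is multiplication by `-q` on exponents. The zeros of the
Hermitian dual of a code are the roots that are not images of zeros of the code. -/
def conjRoot (q : ℕ) (z : K) : K := (z ^ q)⁻¹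

lemma conjRoot_conjRoot (z : K) : conjRoot q (conjRoot q z) = z ^ q ^ 2 := by
  rw [conjRoot, conjRoot, inv_pow, inv_inv, ← pow_mul, sq]

lemma conjRoot_pow (z : K) (m : ℕ) : conjRoot q (z ^ m) = conjRoot q z ^ m := by
  rw [conjRoot, conjRoot, pow_right_comm, inv_pow]

lemma conjRoot_eq_self (ha : a ^ (q + 1) = 1) : conjRoot q a = a :=
  inv_eq_of_mul_eq_one_right ((pow_succ a q).symm.trans ha)

variable {F : Type*} [Field F] [Algebra F K]

lemma conjRoot_injective [Fintype F] (hF : Fintype.card F = q ^ 2) :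
    Function.Injective (conjRoot q : K → K) := by
  obtain ⟨τ, hτ⟩ := exists_ringHom_eq_pow hF K
  intro z w hzw
  exact τ.injective (by simpa only [conjRoot, inv_inj, hτ] using hzw)

lemma aeval_pow_wordPoly_comp [Fintype F] (hF : Fintype.card F = q ^ 2) {σ : F →+* F}
    (hσ : ∀ x, σ x = x ^ q) (z : K) (x : Fin n → F) :
    aeval (z ^ q) (wordPoly (σ ∘ x)) = aeval z (wordPoly x) ^ q := by
  obtain ⟨τ, hτ⟩ := exists_ringHom_eq_pow hF K
  simp only [aeval_wordPoly, ← hτ, map_sum, map_mul, map_pow]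
  simp only [hτ, Function.comp_apply, hσ, map_pow]

lemma finrank_orthogonalBilin_vanishingCode [Fintype F] {σ : F →+* F} {Z : Finset K}
    (hF : Fintype.card F = q ^ 2)
    (hσ : ∀ x, σ x = x ^ q) (hZ : ∀ z ∈ Z, z ^ Fintype.card F ∈ Z) (hZn : Z.card ≤ n) :
    Module.finrank F ((vanishingCode F n Z).orthogonalBilin (hermForm σ)) = Z.card := by
  have hdual := finrank_add_finrank_orthogonalBilin_hermForm
    (Function.Involutive.bijective (apply_apply_eq_self_of_eq_pow hF hσ)) (vanishingCode F n Z)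
  have hdim := finrank_vanishingCode_add_card hZ hZn
  rw [Fintype.card_fin] at hdual
  omega

lemma sum_nthRootsFinset_inv_pow_mul_pow [NeZero n] (hβ : IsPrimitiveRoot β n) (hω : ω ^ n = a)
    (ha : a ≠ 0) (i j : Fin n) :
    ∑ ν ∈ nthRootsFinset n a, ν⁻¹ ^ (i : ℕ) * ν ^ (j : ℕ) = if i = j then (n : K) else 0 := by
  split_ifs with hij
  · subst hij
    rw [Finset.sum_congr rfl fun ν hν => by
      rw [← mul_pow, inv_mul_cancel₀ (ne_zero_of_mem_nthRootsFinset ha hν), one_pow]]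
    rw [Finset.sum_const, card_nthRootsFinset_of_isPrimitiveRoot hβ hω ha, nsmul_one]
  · have hβ0 : β ≠ 0 := hβ.ne_zero NeZero.out
    have hshift : ∑ ν ∈ nthRootsFinset n a, (β * ν)⁻¹ ^ (i : ℕ) * (β * ν) ^ (j : ℕ) =
        ∑ ν ∈ nthRootsFinset n a, ν⁻¹ ^ (i : ℕ) * ν ^ (j : ℕ) :=
      Finset.sum_equiv (Equiv.mulLeft₀ β hβ0) (fun ν => by
        simp [mem_nthRootsFinset (NeZero.pos n), mul_pow, hβ.pow_eq_one]) fun ν _ => rfl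
    simp only [mul_inv, mul_pow, mul_mul_mul_comm _ _ (β ^ (j : ℕ)), ← Finset.mul_sum] at hshift
    by_contra hsum
    have hone := (mul_eq_right₀ hsum).1 hshift
    rw [inv_pow, inv_mul_eq_one₀ (pow_ne_zero _ hβ0)] at hone
    exact hij (Fin.ext (hβ.pow_inj i.isLt j.isLt hone))

variable [NeZero n]

lemma sum_aeval_inv_mul_aeval_wordPoly (hβ : IsPrimitiveRoot β n) (hω : ω ^ n = a) (ha : a ≠ 0)
    (x y : Fin n → F) :
    ∑ ν ∈ nthRootsFinset n a, aeval ν⁻¹ (wordPoly x) * aeval ν (wordPoly y) =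
      n * algebraMap F K (∑ i, x i * y i) := by
  calc ∑ ν ∈ nthRootsFinset n a, aeval ν⁻¹ (wordPoly x) * aeval ν (wordPoly y)
      = ∑ i, ∑ j, ∑ ν ∈ nthRootsFinset n a,
          algebraMap F K (x i * y j) * (ν⁻¹ ^ (i : ℕ) * ν ^ (j : ℕ)) := by
        simp only [aeval_wordPoly, Finset.sum_mul_sum, map_mul]
        rw [Finset.sum_comm]
        refine Finset.sum_congr rfl fun i _ => ?_
        rw [Finset.sum_comm]
        simp only [mul_mul_mul_comm]
    _ = n * algebraMap F K (∑ i, x i * y i) := by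
        simp only [← Finset.mul_sum, sum_nthRootsFinset_inv_pow_mul_pow hβ hω ha, mul_ite, mul_zero,
          Finset.sum_ite_eq, Finset.mem_univ, if_true, map_sum]
        rw [← Finset.sum_mul, mul_comm]

lemma conjRoot_mem_nthRootsFinset (ha : a ^ (q + 1) = 1) {z : K} (hz : z ∈ nthRootsFinset n a) :
    conjRoot q z ∈ nthRootsFinset n a := by
  rw [mem_nthRootsFinset (NeZero.pos n)] at hz ⊢
  rw [← conjRoot_pow, hz, conjRoot_eq_self ha]

variable [Fintype F] [DecidableEq K]

lemma pow_card_mem_sdiff_image_conjRoot (hF : Fintype.card F = q ^ 2) (ha : a ^ (q + 1) = 1)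
    {Z : Finset K} (hZ : ∀ z ∈ Z, z ^ Fintype.card F ∈ Z) :
    ∀ z ∈ nthRootsFinset n a \ Z.image (conjRoot q),
      z ^ Fintype.card F ∈ nthRootsFinset n a \ Z.image (conjRoot q) := by
  intro z hz
  rw [Finset.mem_sdiff, mem_nthRootsFinset (NeZero.pos n)] at hz ⊢
  have haF : a ^ Fintype.card F = a := by
    rw [hF, ← conjRoot_conjRoot, conjRoot_eq_self ha, conjRoot_eq_self ha]
  refine ⟨by rw [pow_right_comm, hz.1, haF], fun hzZ => hz.2 ?_⟩
  obtain ⟨w, hw, hwz⟩ := Finset.mem_image.1 hzZ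
  rw [← image_frobenius_eq hZ] at hw
  obtain ⟨v, hv, rfl⟩ := Finset.mem_image.1 hw
  refine Finset.mem_image.2 ⟨v, hv, (FiniteField.frobeniusAlgHom F K).injective ?_⟩
  exact (conjRoot_pow v _).symm.trans hwz

variable {σ : F →+* F} {Z : Finset K}

lemma card_image_conjRoot (hF : Fintype.card F = q ^ 2) (Z : Finset K) :
    (Z.image (conjRoot q)).card = Z.card :=
  Finset.card_image_of_injective _ (conjRoot_injective hF)

lemma card_sdiff_image_conjRoot_add_card (hF : Fintype.card F = q ^ 2) (hβ : IsPrimitiveRoot β n)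
    (hω : ω ^ n = a) (ha : a ^ (q + 1) = 1) (hZa : Z ⊆ nthRootsFinset n a) :
    (nthRootsFinset n a \ Z.image (conjRoot q)).card + Z.card = n := by
  have ha0 : a ≠ 0 := (IsUnit.of_pow_eq_one ha (Nat.succ_ne_zero q)).ne_zero
  rw [← card_image_conjRoot hF Z, Finset.card_sdiff_add_card_eq_card
    (Finset.image_subset_iff.2 fun z hz => conjRoot_mem_nthRootsFinset ha (hZa hz)),
    card_nthRootsFinset_of_isPrimitiveRoot hβ hω ha0]

theorem orthogonalBilin_vanishingCode (hF : Fintype.card F = q ^ 2) (hσ : ∀ x, σ x = x ^ q)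
    (hβ : IsPrimitiveRoot β n) (hω : ω ^ n = a) (ha : a ^ (q + 1) = 1)
    (hZ : ∀ z ∈ Z, z ^ Fintype.card F ∈ Z) (hZa : Z ⊆ nthRootsFinset n a) :
    (vanishingCode F n Z).orthogonalBilin (hermForm σ) =
      vanishingCode F n (nthRootsFinset n a \ Z.image (conjRoot q)) := by
  have hq0 : q ≠ 0 := fun h => by simp [h] at hF
  have ha0 : a ≠ 0 := (IsUnit.of_pow_eq_one ha (Nat.succ_ne_zero q)).ne_zero
  have : NeZero (n : K) := hβ.neZero'
  symm
  refine Submodule.eq_of_le_of_finrank_eq (fun y hy x hx => ?_) ?_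
  · have hparseval : (n : K) * algebraMap F K (hermForm σ x y) = 0 := by
      rw [hermForm_apply]
      refine (sum_aeval_inv_mul_aeval_wordPoly hβ hω ha0 (σ ∘ x) y).symm.trans ?_
      refine Finset.sum_eq_zero fun ν hν => ?_
      by_cases hνZ : ν ∈ Z.image (conjRoot q)
      · obtain ⟨z, hz, rfl⟩ := Finset.mem_image.1 hνZ
        rw [conjRoot, inv_inv, aeval_pow_wordPoly_comp hF hσ, mem_vanishingCode.1 hx z hz,
          zero_pow hq0, zero_mul]
      · rw [mem_vanishingCode.1 hy ν (Finset.mem_sdiff.2 ⟨hν, hνZ⟩), mul_zero]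
    simpa [NeZero.ne] using hparseval
  · have hcard := card_sdiff_image_conjRoot_add_card hF hβ hω ha hZa
    have hdim := finrank_vanishingCode_add_card (n := n)
      (pow_card_mem_sdiff_image_conjRoot hF ha hZ) (hcard ▸ Nat.le_add_right _ _)
    rw [finrank_orthogonalBilin_vanishingCode hF hσ hZ (by omega)]
    omega

lemma finrank_inf_orthogonalBilin_vanishingCode (hF : Fintype.card F = q ^ 2)
    (hσ : ∀ x, σ x = x ^ q) (hβ : IsPrimitiveRoot β n) (hω : ω ^ n = a) (ha : a ^ (q + 1) = 1)
    (hZ : ∀ z ∈ Z, z ^ Fintype.card F ∈ Z) (hZa : Z ⊆ nthRootsFinset n a) :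
    Module.finrank F ↥(vanishingCode F n Z ⊓ (vanishingCode F n Z).orthogonalBilin (hermForm σ)) +
      (Z ∩ Z.image (conjRoot q)).card = Z.card := by
  have ha0 : a ≠ 0 := (IsUnit.of_pow_eq_one ha (Nat.succ_ne_zero q)).ne_zero
  rw [orthogonalBilin_vanishingCode hF hσ hβ hω ha hZ hZa, vanishingCode_inf_vanishingCode]
  set W := nthRootsFinset n a \ Z.image (conjRoot q) with hW
  have hZW : ∀ z ∈ Z ∪ W, z ^ Fintype.card F ∈ Z ∪ W := fun z hz =>
    Finset.mem_union.2 <| (Finset.mem_union.1 hz).imp (hZ z)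
      (pow_card_mem_sdiff_image_conjRoot hF ha hZ z)
  have hdim := finrank_vanishingCode_add_card hZW <|
    (Finset.card_le_card (Finset.union_subset hZa Finset.sdiff_subset)).trans_eq
      (card_nthRootsFinset_of_isPrimitiveRoot hβ hω ha0)
  have hcardW : W.card + Z.card = n := card_sdiff_image_conjRoot_add_card hF hβ hω ha hZa
  have hinter : Z ∩ W = Z \ Z.image (conjRoot q) := by
    rw [hW, ← Finset.inter_sdiff_assoc, Finset.inter_eq_left.2 hZa]
  have hunion := Finset.card_union_add_card_inter Z W
  have hsdiff := Finset.card_sdiff_add_card_inter Z (Z.image (conjRoot q))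
  rw [hinter] at hunion
  omega

theorem existsEAQECC_of_zeros (hF : Fintype.card F = q ^ 2) (hq : Odd q)
    (hβ : IsPrimitiveRoot β n) (hω : ω ^ n = a) (ha : a ^ (q + 1) = 1)
    (hZ : ∀ z ∈ Z, z ^ Fintype.card F ∈ Z) (hZa : Z ⊆ nthRootsFinset n a) {b : K} (hb : b ≠ 0)
    (hbZ : ∀ l < Z.card, b * β ^ l ∈ Z) {k : ℕ} (hk : 1 ≤ k)
    (hkZ : k + 2 * Z.card = n + (Z ∩ Z.image (conjRoot q)).card) :
    ExistsEAQECC q n k (Z.card + 1) (Z ∩ Z.image (conjRoot q)).card := by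
  classical
  obtain ⟨σ, hσ⟩ := exists_ringHom_eq_pow hF F
  have hZn : Z.card ≤ n :=
    Nat.le.intro (add_comm _ _ |>.trans (card_sdiff_image_conjRoot_add_card hF hβ hω ha hZa))
  have hdim := finrank_vanishingCode_add_card hZ hZn
  have hdual := finrank_orthogonalBilin_vanishingCode hF hσ hZ hZn
  have hhull := finrank_inf_orthogonalBilin_vanishingCode hF hσ hβ hω ha hZ hZa
  have hdist : ∀ x ∈ vanishingCode F n Z, x ≠ 0 → Z.card + 1 ≤ hammingNorm x := fun x hx hx0 =>
    lt_hammingNorm_of_mem_vanishingCode hβ hb hbZ hx hx0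
  obtain ⟨e, he, hed, heD⟩ : ∃ e ∈ vanishingCode F n Z, hammingNorm e = Z.card + 1 ∧
      e ∉ (vanishingCode F n Z).orthogonalBilin (hermForm σ) := by
    by_contra! hE
    have hle := le_of_forall_hammingNorm_eq_mem (by rw [Fintype.card_fin]; omega) hdist hE
    rw [inf_eq_left.2 hle] at hhull
    omega
  exact existsEAQECC_of_hermForm hF hq hσ hk (by omega) (by omega) hdist he heD hed

end HermitianDual

section SymmetricZeros

variable {K : Type*} [Field K] {n q m : ℕ} {β ω : K}

lemma mul_zpow_eq_mul_zpow_iff [NeZero n] (hβ : IsPrimitiveRoot β n) (hω : ω ≠ 0) {i j : ℤ} :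
    ω * β ^ i = ω * β ^ j ↔ (n : ℤ) ∣ i - j := by
  have hβ0 : β ≠ 0 := hβ.ne_zero NeZero.out
  rw [mul_right_inj' hω, ← hβ.zpow_eq_one_iff_dvd, zpow_sub₀ hβ0,
    div_eq_one_iff_eq (zpow_ne_zero _ hβ0)]

lemma injOn_mul_zpow (hβ : IsPrimitiveRoot β n) (hω : ω ≠ 0) (hm : 2 * m < n) :
    Set.InjOn (fun j : ℤ => ω * β ^ j) (Finset.Icc (-m : ℤ) m) := by
  have : NeZero n := ⟨by omega⟩
  intro i hi j hj h
  rw [Finset.coe_Icc, Set.mem_Icc] at hi hj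
  have hdvd := (mul_zpow_eq_mul_zpow_iff hβ hω).1 h
  have := Int.eq_zero_of_abs_lt_dvd hdvd (abs_lt.2 ⟨by omega, by omega⟩)
  omega

lemma conjRoot_mul_zpow (hω : ω ^ (q + 1) = 1) (j : ℤ) :
    conjRoot q (ω * β ^ j) = ω * β ^ (-(q * j)) := by
  have h := conjRoot_eq_self hω
  rw [conjRoot] at h ⊢
  rw [mul_pow, mul_inv, h, ← zpow_natCast, ← zpow_mul, ← zpow_neg, mul_comm j]

section

variable [DecidableEq K]

/-- The `2m + 1` consecutive roots `ω β ^ j`, `-m ≤ j ≤ m`, of `X ^ n - ω ^ n`. -/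
noncomputable def symmZeros (ω β : K) (m : ℕ) : Finset K :=
  (Finset.Icc (-m : ℤ) m).image fun j => ω * β ^ j

lemma mem_symmZeros {z : K} : z ∈ symmZeros ω β m ↔ ∃ j ∈ Finset.Icc (-m : ℤ) m, ω * β ^ j = z :=
  Finset.mem_image

/-- The `j ∈ [-m, m]` such that `-j` is congruent modulo `n` to `q` times an element of `[-m, m]`;
they are the exponents of the roots in `symmZeros ω β m ∩ (symmZeros ω β m).image (conjRoot q)`. -/
noncomputable def conjPairedExponents (q n m : ℕ) : Finset ℤ :=
  {j ∈ Finset.Icc (-m : ℤ) m | ∃ l ∈ Finset.Icc (-m : ℤ) m, (n : ℤ) ∣ q * l + j}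

lemma card_symmZeros (hβ : IsPrimitiveRoot β n) (hω : ω ≠ 0) (hm : 2 * m < n) :
    (symmZeros ω β m).card = 2 * m + 1 := by
  rw [symmZeros, Finset.card_image_of_injOn (injOn_mul_zpow hβ hω hm), Int.card_Icc]
  omega

lemma symmZeros_subset_nthRootsFinset [NeZero n] (hβ : IsPrimitiveRoot β n) :
    symmZeros ω β m ⊆ nthRootsFinset n (ω ^ n) := by
  intro z hz
  obtain ⟨j, -, rfl⟩ := mem_symmZeros.1 hz
  rw [mem_nthRootsFinset (NeZero.pos n), mul_pow, ← zpow_natCast, ← zpow_natCast (β ^ j),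
    zpow_comm, zpow_natCast β, hβ.pow_eq_one, one_zpow, mul_one]

lemma pow_sq_mem_symmZeros (hβ : IsPrimitiveRoot β n) (hω : ω ^ (q + 1) = 1)
    (hn : n ∣ q ^ 2 + 1) {z : K} (hz : z ∈ symmZeros ω β m) : z ^ q ^ 2 ∈ symmZeros ω β m := by
  have hω0 : ω ≠ 0 := (IsUnit.of_pow_eq_one hω (Nat.succ_ne_zero q)).ne_zero
  have : NeZero n := ⟨fun h => by simp [h] at hn⟩
  obtain ⟨j, hj, rfl⟩ := mem_symmZeros.1 hz
  rw [Finset.mem_Icc] at hj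
  refine mem_symmZeros.2 ⟨-j, Finset.mem_Icc.2 ⟨by omega, by omega⟩, ?_⟩
  rw [← conjRoot_conjRoot, conjRoot_mul_zpow hω, conjRoot_mul_zpow hω,
    mul_zpow_eq_mul_zpow_iff hβ hω0,
    show -j - -(q * -(q * j) : ℤ) = ((q ^ 2 + 1 : ℕ) : ℤ) * -j by push_cast; ring]
  exact (Int.natCast_dvd_natCast.2 hn).mul_right _

lemma card_symmZeros_inter_image_conjRoot (hβ : IsPrimitiveRoot β n) (hω : ω ^ (q + 1) = 1)
    (hm : 2 * m < n) :
    (symmZeros ω β m ∩ (symmZeros ω β m).image (conjRoot q)).card =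
      (conjPairedExponents q n m).card := by
  have hω0 : ω ≠ 0 := (IsUnit.of_pow_eq_one hω (Nat.succ_ne_zero q)).ne_zero
  have : NeZero n := ⟨by omega⟩
  have himage : symmZeros ω β m ∩ (symmZeros ω β m).image (conjRoot q) =
      (conjPairedExponents q n m).image fun j => ω * β ^ j := by
    ext z
    simp only [conjPairedExponents, symmZeros, Finset.image_image, Finset.mem_inter,
      Finset.mem_image, Finset.mem_filter, Function.comp_apply, conjRoot_mul_zpow hω]
    constructor
    · rintro ⟨⟨j, hj, rfl⟩, l, hl, hlj⟩
      refine ⟨j, ⟨hj, l, hl, ?_⟩, rfl⟩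
      rw [eq_comm, mul_zpow_eq_mul_zpow_iff hβ hω0, sub_neg_eq_add, add_comm] at hlj
      exact hlj
    · rintro ⟨j, ⟨hj, l, hl, hlj⟩, rfl⟩
      refine ⟨⟨j, hj, rfl⟩, l, hl, ?_⟩
      rw [eq_comm, mul_zpow_eq_mul_zpow_iff hβ hω0, sub_neg_eq_add, add_comm]
      exact hlj
  rw [himage, Finset.card_image_of_injOn]
  exact (injOn_mul_zpow hβ hω0 hm).mono (Finset.coe_subset.2 (Finset.filter_subset _ _))

end

theorem existsEAQECC_of_symmZeros {F : Type*} [Field F] [Fintype F] [Algebra F K]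
    (hF : Fintype.card F = q ^ 2) (hq : Odd q) (hβ : IsPrimitiveRoot β n) (hω : ω ^ (q + 1) = 1)
    (hn : n ∣ q ^ 2 + 1) (hm : 2 * m < n) {k : ℕ} (hk : 1 ≤ k)
    (hkm : k + 2 * (2 * m + 1) = n + (conjPairedExponents q n m).card) :
    ExistsEAQECC q n k (2 * m + 2) (conjPairedExponents q n m).card := by
  classical
  have hω0 : ω ≠ 0 := (IsUnit.of_pow_eq_one hω (Nat.succ_ne_zero q)).ne_zero
  have : NeZero n := ⟨by omega⟩
  have hβ0 : β ≠ 0 := hβ.ne_zero NeZero.out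
  rw [← card_symmZeros hβ hω0 hm, ← card_symmZeros_inter_image_conjRoot hβ hω hm] at hkm
  convert existsEAQECC_of_zeros hF hq hβ rfl (by rw [pow_right_comm, hω, one_pow])
    (fun z hz => hF ▸ pow_sq_mem_symmZeros hβ hω hn hz) (symmZeros_subset_nthRootsFinset hβ)
    (b := ω * β ^ (-m : ℤ)) (mul_ne_zero hω0 (zpow_ne_zero _ hβ0)) ?_ hk hkm using 1
  · rw [card_symmZeros hβ hω0 hm]
  · rw [card_symmZeros_inter_image_conjRoot hβ hω hm]
  · intro l hl
    rw [card_symmZeros hβ hω0 hm] at hl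
    refine mem_symmZeros.2 ⟨-m + l, Finset.mem_Icc.2 ⟨by omega, by omega⟩, ?_⟩
    rw [mul_assoc, zpow_add₀ hβ0, zpow_natCast]

end SymmetricZeros

section LatticeCount

lemma dvd_iff_exists_lattice_coords {t l j : ℤ} :
    10 * t ^ 2 + 6 * t + 1 ∣ (10 * t + 3) * l + j ↔
      ∃ x y : ℤ, x * t + y * (3 * t + 1) = l ∧ x * (3 * t + 1) - y * t = j := by
  constructor
  · rintro ⟨z, hz⟩
    exact ⟨(3 * t + 1) * z - 3 * l, l - t * z, by ring, by linear_combination -hz⟩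
  · rintro ⟨x, y, rfl, rfl⟩
    exact ⟨x + 3 * y, by ring⟩

lemma abs_coords_le_one {t x y : ℤ} (ht : 1 ≤ t) (hl : |x * t + y * (3 * t + 1)| ≤ 5 * t)
    (hj : |x * (3 * t + 1) - y * t| ≤ 5 * t) : |x| ≤ 1 ∧ |y| ≤ 1 := by
  set l := x * t + y * (3 * t + 1) with hldef
  set j := x * (3 * t + 1) - y * t with hjdef
  have hx : (10 * t ^ 2 + 6 * t + 1) * x = t * l + (3 * t + 1) * j := by rw [hldef, hjdef]; ring
  have hy : (10 * t ^ 2 + 6 * t + 1) * y = (3 * t + 1) * l - t * j := by rw [hldef, hjdef]; ring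
  rw [abs_le] at hl hj ⊢
  rw [abs_le]
  refine ⟨⟨?_, ?_⟩, ?_, ?_⟩ <;> nlinarith

lemma abs_mul_add_mul_le {t x y : ℤ} (ht : 1 ≤ t) (hx : |x| ≤ 1) (hy : |y| ≤ 1) :
    |x * t + y * (3 * t + 1)| ≤ 4 * t + 1 := by
  rw [abs_le] at *
  constructor <;> nlinarith

lemma injOn_coords {t : ℤ} (ht : 1 ≤ t) :
    Set.InjOn (fun p : ℤ × ℤ => p.1 * (3 * t + 1) - p.2 * t)
      ↑(Finset.Icc (-1 : ℤ) 1 ×ˢ Finset.Icc (-1 : ℤ) 1) := by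
  rintro ⟨x, y⟩ h ⟨x', y'⟩ h' he
  simp only [Finset.coe_product, Finset.coe_Icc, Set.mem_prod, Set.mem_Icc] at h h' he
  have hx : x = x' := by
    apply le_antisymm <;> by_contra! hlt <;> nlinarith
  subst hx
  have hy : y = y' := mul_right_cancel₀ (by omega : t ≠ 0) (by linarith)
  rw [hy]

theorem card_conjPairedExponents {t m : ℕ} (ht : 1 ≤ t) (hm : 4 * t + 1 ≤ m) (hm' : m ≤ 5 * t) :
    (conjPairedExponents (10 * t + 3) (10 * t ^ 2 + 6 * t + 1) m).card = 9 := by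
  have ht' : (1 : ℤ) ≤ t := by exact_mod_cast ht
  have himage : conjPairedExponents (10 * t + 3) (10 * t ^ 2 + 6 * t + 1) m =
      (Finset.Icc (-1 : ℤ) 1 ×ˢ Finset.Icc (-1 : ℤ) 1).image
        fun p => p.1 * (3 * (t : ℤ) + 1) - p.2 * t := by
    ext j
    simp only [conjPairedExponents, Finset.mem_filter, Finset.mem_image, Finset.mem_product,
      Finset.mem_Icc, ← abs_le, Prod.exists]
    push_cast
    simp only [dvd_iff_exists_lattice_coords]
    constructor
    · rintro ⟨hj, l, hl, x, y, rfl, rfl⟩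
      exact ⟨x, y, abs_coords_le_one ht' (by omega) (by omega), rfl⟩
    · rintro ⟨x, y, ⟨hx, hy⟩, rfl⟩
      have hj := abs_mul_add_mul_le ht' ((abs_neg y).trans_le hy) hx
      have hl := abs_mul_add_mul_le ht' hx hy
      rw [neg_mul, neg_add_eq_sub] at hj
      exact ⟨by omega, _, by omega, x, y, rfl, rfl⟩
  rw [himage, Finset.card_image_of_injOn (injOn_coords ht')]
  rfl

end LatticeCount

section DefiningSet

lemma cyclotomicCoset_eq_pair {Q N : ℕ} {x y : ZMod N} (hxy : x * Q = y) (hyx : y * Q = x) :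
    cyclotomicCoset Q N x = {x, y} := by
  ext z
  simp only [cyclotomicCoset, Set.mem_ofPred_eq, Set.mem_insert_iff, Set.mem_singleton_iff]
  constructor
  · rintro ⟨j, rfl⟩
    induction j with
    | zero => simp
    | succ j ih => rcases ih with ih | ih <;> simp [pow_succ, ← mul_assoc, ih, hxy, hyx]
  · rintro (rfl | rfl)
    · exact ⟨0, by simp⟩
    · exact ⟨1, by simp [hxy]⟩

lemma iUnion_cyclotomicCoset_eq_image {Q N : ℕ} {s r : ZMod N} (hs : s * Q = s) (hr : r * Q = -r)
    (m : ℕ) :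
    ⋃ j ∈ Set.Icc 0 m, cyclotomicCoset Q N (s - r * (j : ZMod N)) =
      (fun j : ℤ => s + r * (j : ZMod N)) '' Finset.Icc (-m : ℤ) m := by
  have hcoset (j : ZMod N) : cyclotomicCoset Q N (s - r * j) = {s - r * j, s + r * j} :=
    cyclotomicCoset_eq_pair (by linear_combination hs - j * hr) (by linear_combination hs + j * hr)
  ext x
  simp only [hcoset, Set.mem_iUnion₂, Set.mem_Icc, Set.mem_insert_iff, Set.mem_singleton_iff,
    Finset.coe_Icc, Set.mem_image]
  constructor
  · rintro ⟨j, ⟨-, hj⟩, rfl | rfl⟩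
    · exact ⟨-j, by omega, by push_cast; ring⟩
    · exact ⟨j, by omega, by push_cast; ring⟩
  · rintro ⟨j, hj, rfl⟩
    obtain ⟨l, rfl | rfl⟩ := Int.eq_nat_or_neg j
    · exact ⟨l, by omega, Or.inr (by push_cast; ring)⟩
    · exact ⟨l, by omega, Or.inl (by push_cast; ring)⟩

lemma one_add_mul_intCast_mem_rootExponents {r n : ℕ} [NeZero n] (a : ℤ) :
    (1 + r * a : ZMod (r * n)) ∈ rootExponents r n := by
  have hn : (0 : ℤ) < n := by exact_mod_cast NeZero.pos n
  have hmod : ((a % n).toNat : ℤ) = a % n := Int.toNat_of_nonneg (Int.emod_nonneg a hn.ne')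
  have hrn : (r * n : ZMod (r * n)) = 0 := by exact_mod_cast ZMod.natCast_self (r * n)
  refine ⟨(a % n).toNat, ?_, ?_⟩
  · have := Int.emod_lt_of_pos a hn
    omega
  · rw [← Int.cast_natCast (R := ZMod (r * n)) (a % n).toNat, hmod, Int.emod_def]
    push_cast
    linear_combination ((a / n : ℤ) : ZMod (r * n)) * hrn

variable {K : Type*} [Field K] [DecidableEq K]

lemma coe_symmZeros_eq_image {N : ℕ} [NeZero N] {δ : K} (hδ : IsPrimitiveRoot δ N) (r s m : ℕ) :
    (symmZeros (δ ^ s) (δ ^ r) m : Set K) = (fun i : ZMod N => δ ^ i.val) ''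
      ((fun j : ℤ => (s + r * j : ZMod N)) '' Finset.Icc (-m : ℤ) m) := by
  have hδ0 : δ ≠ 0 := hδ.ne_zero NeZero.out
  rw [symmZeros, Finset.coe_image, Set.image_image]
  refine Set.image_congr fun j _ => ?_
  rw [pow_val_eq_zpow_of_intCast_eq hδ (a := s + r * j) (by push_cast; rfl), zpow_add₀ hδ0,
    zpow_mul, zpow_natCast, zpow_natCast]

end DefiningSet

section SymmetricDefiningSet

variable {K : Type*} [Field K] {q n : ℕ} {δ : K}

lemma pow_half_sq_add_one_pow_eq_one (hn : 2 * n ∣ q ^ 2 + 1) (hδ : δ ^ ((q + 1) * n) = 1) :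
    (δ ^ ((q ^ 2 + 1) / 2)) ^ (q + 1) = 1 := by
  obtain ⟨e, he⟩ := hn
  rw [he, mul_assoc, Nat.mul_div_cancel_left _ two_pos, ← pow_mul,
    show n * e * (q + 1) = (q + 1) * n * e by ring, pow_mul, hδ, one_pow]

lemma half_sq_add_one_eq (hq : Odd q) : (q ^ 2 + 1) / 2 = 1 + (q + 1) * (q / 2) := by
  obtain ⟨p, rfl⟩ := hq
  rw [show (2 * p + 1) ^ 2 + 1 = 2 * (1 + (2 * p + 1 + 1) * p) by ring,
    Nat.mul_div_cancel_left _ two_pos, show (2 * p + 1) / 2 = p by omega]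

lemma iUnion_cyclotomicCoset_half_sq_add_one (hn : 2 * n ∣ q ^ 2 + 1) (m : ℕ) :
    ⋃ j ∈ Set.Icc (0 : ℕ) m, cyclotomicCoset (q ^ 2) ((q + 1) * n)
        (((q ^ 2 + 1) / 2 : ℕ) - (q + 1 : ℕ) * (j : ZMod ((q + 1) * n))) =
      (fun j : ℤ => (((q ^ 2 + 1) / 2 : ℕ) + (q + 1 : ℕ) * j : ZMod ((q + 1) * n))) ''
        Finset.Icc (-m : ℤ) m := by
  have hsq : (q ^ 2 : ZMod ((q + 1) * n)) + 1 = 2 * ((q ^ 2 + 1) / 2 : ℕ) := by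
    exact_mod_cast congrArg _ (Nat.mul_div_cancel' (dvd_of_mul_right_dvd hn)).symm
  obtain ⟨e, he⟩ : n ∣ (q ^ 2 + 1) / 2 := (Nat.dvd_div_iff_mul_dvd (dvd_of_mul_right_dvd hn)).2 hn
  have hmod : ((q : ZMod ((q + 1) * n)) + 1) * n = 0 := by
    exact_mod_cast ZMod.natCast_self ((q + 1) * n)
  rw [he] at hsq ⊢
  push_cast at hsq
  refine iUnion_cyclotomicCoset_eq_image ?_ ?_ m
  · push_cast
    linear_combination (e * (q - 1) : ZMod ((q + 1) * n)) * hmod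
  · push_cast
    linear_combination (q + 1 : ZMod ((q + 1) * n)) * hsq + 2 * e * hmod

lemma half_sq_add_one_add_mul_mem_rootExponents [NeZero n] (hq : Odd q) (j : ℤ) :
    (((q ^ 2 + 1) / 2 : ℕ) + (q + 1 : ℕ) * j : ZMod ((q + 1) * n)) ∈ rootExponents (q + 1) n := by
  convert one_add_mul_intCast_mem_rootExponents (r := q + 1) (n := n) ((q / 2 : ℕ) + j) using 1
  rw [half_sq_add_one_eq hq]
  generalize q / 2 = p
  push_cast
  ring

theorem isConstacyclicWithDefiningSet_vanishingCode_symmZeros {F : Type*} [Field F] [Fintype F]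
    [Algebra F K] [DecidableEq K] [NeZero n] {α : F} (hF : Fintype.card F = q ^ 2)
    (hn : 2 * n ∣ q ^ 2 + 1) (hδ : IsPrimitiveRoot δ ((q + 1) * n))
    (hδα : δ ^ n = algebraMap F K α) (m : ℕ) :
    IsConstacyclicWithDefiningSet (q + 1) n α δ
      (vanishingCode F n (symmZeros (δ ^ ((q ^ 2 + 1) / 2)) (δ ^ (q + 1)) m))
      (⋃ j ∈ Set.Icc (0 : ℕ) m, cyclotomicCoset (q ^ 2) ((q + 1) * n)
        (((q ^ 2 + 1) / 2 : ℕ) - (q + 1 : ℕ) * (j : ZMod ((q + 1) * n)))) := by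
  have hN : 0 < (q + 1) * n := Nat.mul_pos q.succ_pos (NeZero.pos n)
  have : NeZero ((q + 1) * n) := ⟨hN.ne'⟩
  have hq : Odd q := by
    have h := even_iff_two_dvd.2 (dvd_of_mul_right_dvd hn)
    simpa [parity_simps] using h
  rw [iUnion_cyclotomicCoset_half_sq_add_one hn]
  refine isConstacyclicWithDefiningSet_vanishingCode hδ hδα ?_
    (coe_symmZeros_eq_image hδ (q + 1) _ m) fun z hz => ?_
  · rintro _ ⟨j, -, rfl⟩
    exact half_sq_add_one_add_mul_mem_rootExponents hq j
  · rw [hF]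
    exact pow_sq_mem_symmZeros (hδ.pow hN rfl) (pow_half_sq_add_one_pow_eq_one hn hδ.pow_eq_one)
      (dvd_of_mul_left_dvd hn) hz

end SymmetricDefiningSet

theorem mainTheorem4 {F K : Type*} [Field F] [Fintype F] [Field K] [Algebra F K]
    (q n lam : ℕ) (hF : Fintype.card F = q ^ 2) (hq : q ≡ 3 [MOD 10])
    (hn : 10 * n = q ^ 2 + 1) (hlam : 1 ≤ lam) (hlam' : 10 * lam ≤ q - 3)
    (α : F) (hα : IsPrimitiveRoot α (q + 1))
    (δ : K) (hδ : IsPrimitiveRoot δ ((q + 1) * n)) (hδα : δ ^ n = algebraMap F K α)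
    (T : Set (ZMod ((q + 1) * n)))
    (hT : T = ⋃ j ∈ Set.Icc (0 : ℕ) (4 * (q - 3) / 10 + lam),
      cyclotomicCoset (q ^ 2) ((q + 1) * n)
        ((((q ^ 2 + 1) / 2 : ℕ) : ZMod ((q + 1) * n)) -
          ((q + 1 : ℕ) : ZMod ((q + 1) * n)) * (j : ZMod ((q + 1) * n)))) :
    (∃ 𝒞 : Submodule F (Fin n → F), IsConstacyclicWithDefiningSet (q + 1) n α δ 𝒞 T) ∧
    ∀ 𝒞 : Submodule F (Fin n → F), IsConstacyclicWithDefiningSet (q + 1) n α δ 𝒞 T →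
      ∃ k d : ℕ,
        (k : ℚ) = n - 8 / 5 * ((q : ℚ) - 3) - 4 * lam + 7 ∧
        (d : ℚ) = 4 / 5 * ((q : ℚ) - 3) + 2 * lam + 2 ∧
        ExistsEAQECC q n k d 9 ∧
        (n : ℤ) + 9 - k = 2 * ((d : ℤ) - 1) ∧
        (q ≠ 13 → 2 * d ≤ n + 2) := by
  classical
  have hn2 : 2 * n ∣ q ^ 2 + 1 := ⟨5, by omega⟩
  have : NeZero n := ⟨by omega⟩
  refine ⟨⟨_, hT ▸ isConstacyclicWithDefiningSet_vanishingCode_symmZeros hF hn2 hδ hδα _⟩,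
    fun _ _ => ?_⟩
  obtain ⟨t, rfl⟩ : ∃ t, q = 10 * t + 3 := ⟨q / 10, by unfold Nat.ModEq at hq; omega⟩
  have hnt : n = 10 * t ^ 2 + 6 * t + 1 := by linarith
  have ht : 1 ≤ t := by omega
  have hlt : lam ≤ t := by omega
  have ht2 : 3 * t ≤ 2 * t ^ 2 + 1 := by nlinarith
  obtain ⟨k, hk⟩ : ∃ k, k + 4 * (4 * t + lam) = n + 7 := ⟨n + 7 - 4 * (4 * t + lam), by omega⟩
  refine ⟨k, 2 * (4 * t + lam) + 2, ?_, by push_cast; ring, ?_, by push_cast; omega, fun h13 => ?_⟩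
  · have hkQ : (k + 4 * (4 * t + lam) : ℚ) = n + 7 := mod_cast hk
    push_cast
    linarith
  · have hcard := card_conjPairedExponents ht (m := 4 * t + lam) (by omega) (by omega)
    rw [← hnt] at hcard
    exact hcard ▸ existsEAQECC_of_symmZeros hF (by grind) (hδ.pow (NeZero.pos _) rfl)
      (pow_half_sq_add_one_pow_eq_one hn2 hδ.pow_eq_one) (dvd_of_mul_left_dvd hn2)
      (by omega) (by omega) (by omega)
  · have : 2 * t ≤ t ^ 2 := by nlinarith [show 2 ≤ t by omega]
    omega
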